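/- Let $T>0$, $\omega=\frac{2\pi}{T}$, $p>0$, $c\in\mathbb R$ and $0<b<\omega^2$. Let $a,e:\mathbb R\to\mathbb R$ be continuous and $T$-periodic, with $a(t)>0$ for all $t$ and $\int_0^T e(t)\,dt=0$. For $\mu\in\mathbb R$ consider positive $T$-periodic classical (that is, $C^2$) solutions $u$ of $$u''(t)+c\,u'(t)+b\,u(t)+\frac{a(t)}{u(t)^p}=\mu+e(t),\qquad u(t+T)=u(t). \tag{1}$$ Then there is $\mu_0>0$ such that (1) has exactly two, exactly one, or no positive $T$-periodic solutions according as $\mu>\mu_0$, $\mu=\mu_0$, or $\mu<\mu_0$. Moreover, write $u(t)=\xi+U(t)$ with $\int_0^T U(t)\,dt=0$, so that $\xi=\frac1T\int_0^T u(t)\,dt$. There are $\bar\xi\ge 0$ and a function $\mu=\varphi(\xi)$, $\xi\in(\bar\xi,\infty)$, such that: 1. for every $\xi>\bar\xi$ there is exactly one pair $(u,\mu)$ such that $u$ is a positive $T$-periodic solution of (1) of average $\xi$; for this pair $\mu=\varphi(\xi)$, and $u=u_\xi$ depends continuously on $\xi$ in the norm of $H^2(0,T)$; 2. every positive $T$-periodic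 solution $u$ of (1), for any $\mu$, has average $\xi>\bar\xi$, so that all solution pairs lie on the curve $\mu=\varphi(\xi)$, and the pair $(u,\mu)$ is determined by $\xi$; 3. the curve is parabola-like: $\varphi$ is continuous on $(\bar\xi,\infty)$, and there is $\xi_0>\bar\xi$ with $\varphi(\xi_0)=\mu_0$ such that $\varphi$ is strictly decreasing on $(\bar\xi,\xi_0]$ and strictly increasing on $[\xi_0,\infty)$; furthermore $\lim_{\xi\to\bar\xi^+}\varphi(\xi)=\infty$ and $\lim_{\xi\to\infty}\varphi(\xi)=\infty$. If $a(t)$ is constant, then $\bar\xi=0$. -/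

import Mathlib

open Set Filter Topology

noncomputable section

/-- `u` is a positive `T`-periodic classical solution of
`u'' + c u' + b u + a(t) / u^p = μ + e(t)`. -/
structure IsPosPeriodicSol (T p b c : ℝ) (a e : ℝ → ℝ) (μ : ℝ) (u : ℝ → ℝ) : Prop where
  contDiff : ContDiff ℝ 2 u
  periodic : Function.Periodic u T
  pos : ∀ t, 0 < u t
  eqn : ∀ t, deriv (deriv u) t + c * deriv u t + b * u t + a t / (u t) ^ p = μ + e t

/-- The average of a `T`-periodic function over one period; it is the number `ξ` for which
`u = ξ + U` with `∫₀ᵀ U = 0`. -/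
def periodAverage (T : ℝ) (u : ℝ → ℝ) : ℝ := (1 / T) * ∫ t in (0 : ℝ)..T, u t

/-- The squared distance of two `C²` functions of period `T` in the Sobolev space `H²(0, T)`. -/
def sqDistH2 (T : ℝ) (u v : ℝ → ℝ) : ℝ :=
  ∫ t in (0 : ℝ)..T, ((u t - v t) ^ 2 + (deriv u t - deriv v t) ^ 2
    + (deriv (deriv u) t - deriv (deriv v) t) ^ 2)

/-- `φ` is a parabola-like function on `(ξbar, ∞)` with vertex `(ξ₀, μ₀)`: it is continuous,
strictly decreasing up to `ξ₀`, strictly increasing from `ξ₀` on, takes its minimum `μ₀` at `ξ₀`,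
and tends to infinity at both ends. -/
structure IsParabolaLike (φ : ℝ → ℝ) (ξbar ξ₀ μ₀ : ℝ) : Prop where
  continuousOn : ContinuousOn φ (Ioi ξbar)
  vertex_mem : ξbar < ξ₀
  vertex_val : φ ξ₀ = μ₀
  strictAntiOn : StrictAntiOn φ (Ioc ξbar ξ₀)
  strictMonoOn : StrictMonoOn φ (Ici ξ₀)
  tendsto_left : Tendsto φ (𝓝[>] ξbar) atTop
  tendsto_right : Tendsto φ atTop atTop

end

open MeasureTheory intervalIntegral

/-! ### Periodic functions -/

/-! Fix the average `ξ` and treat `μ` as a Lagrange multiplier. On mean-zero periodic functions the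
damping term integrates to nothing against its own function, Wirtinger's inequality makes `-u'' - b
u` coercive because `b < ω²`, and `u ↦ u ^ (-p)` is decreasing. The equation is therefore strictly
monotone once `ξ` is prescribed: testing the difference of two solutions with itself gives
uniqueness, and for two different averages it gives Lipschitz dependence of `(u, μ)` on `ξ`
(`IsPosPeriodicSol.exists_lipschitz_bound`).

Existence holds for every `ξ > 0`. Truncating the singularity as `max u δ` makes the nonlinearity
Lipschitz, and a contraction argument solves the truncated problem (`exists_periodic_of_lipschitz`).
Since the singular term only helps where `u` lies below its average, energy estimates and evaluation
at the minimum bound `u` below independently of small `δ` (`IsPeriodicJet.exists_lower_bound`), so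
the truncation is inactive. Hence the curve is a graph over `(0, ∞)`, and `ξbar = 0` for every
admissible `a`.

The shape comes from counting. For one `μ`, a Sturm comparison shows that every nodal interval of a
difference of two solutions is longer than `T / 2`; a sign change would put two of them in one
period, so distinct solutions are strictly ordered (`IsPosPeriodicSol.lt_or_gt`). Three ordered
solutions are excluded by strict convexity of `u ^ (-p)` (`IsPosPeriodicSol.not_lt_lt`). Thus `φ`
takes each value at most twice. Integrating the equation gives `φ ξ > b ξ`, and evaluating it at the
minimum of `u` gives blow-up as `ξ → 0`. A continuous function with these properties is
parabola-like (`exists_isParabolaLike`). -/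

theorem Function.Periodic.deriv_periodic {f : ℝ → ℝ} {T : ℝ} (hf : Function.Periodic f T) :
    Function.Periodic (deriv f) T := by
  intro t
  have h : (fun x => f (x + T)) = f := funext hf
  rw [← deriv_comp_add_const, h]

theorem Function.Periodic.integral_deriv_eq_zero {f f' : ℝ → ℝ} {T : ℝ}
    (hf : Function.Periodic f T) (hd : ∀ t, HasDerivAt f (f' t) t) (hc : Continuous f') :
    ∫ t in (0 : ℝ)..T, f' t = 0 := by
  rw [integral_eq_sub_of_hasDerivAt (fun t _ => hd t) (hc.intervalIntegrable _ _)]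
  have := hf 0
  rw [zero_add] at this
  rw [this, sub_self]

theorem Function.Periodic.exists_forall_le_of_continuous {f : ℝ → ℝ} {T : ℝ}
    (hT : 0 < T) (hf : Function.Periodic f T) (hc : Continuous f) : ∃ s, ∀ t, f s ≤ f t := by
  obtain ⟨s, -, hs⟩ := isCompact_Icc.exists_isMinOn (nonempty_Icc.2 hT.le) hc.continuousOn
  refine ⟨s, fun t => ?_⟩
  obtain ⟨r, hr, hrt⟩ := hf.exists_mem_Ico₀ hT t
  rw [hrt]
  exact hs (Ico_subset_Icc_self hr)

theorem Function.Periodic.exists_forall_ge_of_continuous {f : ℝ → ℝ} {T : ℝ}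
    (hT : 0 < T) (hf : Function.Periodic f T) (hc : Continuous f) : ∃ s, ∀ t, f t ≤ f s := by
  obtain ⟨s, hs⟩ := Function.Periodic.exists_forall_le_of_continuous (f := fun t => - f t) hT
    (fun t => by simp only [hf t]) hc.neg
  exact ⟨s, fun t => neg_le_neg_iff.1 (hs t)⟩

theorem Function.Periodic.exists_abs_le_of_continuous {f : ℝ → ℝ} {T : ℝ}
    (hT : 0 < T) (hf : Function.Periodic f T) (hc : Continuous f) : ∃ C, 0 ≤ C ∧ ∀ t, |f t| ≤ C := by
  obtain ⟨s, hs⟩ := Function.Periodic.exists_forall_ge_of_continuous (f := fun t => |f t|) hT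
    (fun t => by simp only [hf t]) hc.abs
  exact ⟨_, abs_nonneg _, hs⟩

theorem ContDiff.hasDerivAt_of_two {u : ℝ → ℝ} (hu : ContDiff ℝ 2 u) :
    (∀ t, HasDerivAt u (deriv u t) t) ∧ (∀ t, HasDerivAt (deriv u) (deriv (deriv u) t) t) ∧
      Continuous (deriv (deriv u)) := by
  have h1 : ContDiff ℝ 1 (deriv u) := by
    have : ContDiff ℝ (1 + 1) u := by simpa [one_add_one_eq_two] using hu
    exact (contDiff_succ_iff_deriv.1 this).2.2
  exact ⟨fun t => (hu.differentiable (by norm_num)).differentiableAt.hasDerivAt,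
    fun t => (h1.differentiable (by norm_num)).differentiableAt.hasDerivAt,
    h1.continuous_deriv (by norm_num)⟩

theorem contDiff_two_of_hasDerivAt {u u' u'' : ℝ → ℝ} (h1 : ∀ t, HasDerivAt u (u' t) t)
    (h2 : ∀ t, HasDerivAt u' (u'' t) t) (hc : Continuous u'') : ContDiff ℝ 2 u := by
  have e1 : deriv u = u' := funext fun t => (h1 t).deriv
  have e2 : deriv u' = u'' := funext fun t => (h2 t).deriv
  have : ContDiff ℝ (1 + 1) u := by
    refine contDiff_succ_iff_deriv.2 ⟨fun t => (h1 t).differentiableAt, by simp, ?_⟩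
    rw [e1]
    exact contDiff_one_iff_deriv.2 ⟨fun t => (h2 t).differentiableAt, by rwa [e2]⟩
  simpa [one_add_one_eq_two] using this

/-! ### Integral inequalities for periodic functions of mean zero -/

/-- Parseval: the `i`-th Fourier coefficient of `U'` is that of `U` times a factor of modulus `|i|
ω`, and the coefficient at `i = 0` vanishes. -/
theorem wirtinger_inequality {U U' : ℝ → ℝ} {T : ℝ} (hT : 0 < T) (hper : Function.Periodic U T)
    (hd : ∀ t, HasDerivAt U (U' t) t) (hc : Continuous U') (hU : ∫ t in (0 : ℝ)..T, U t = 0) :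
    (2 * Real.pi / T) ^ 2 * ∫ t in (0 : ℝ)..T, U t ^ 2 ≤ ∫ t in (0 : ℝ)..T, U' t ^ 2 := by
  have hUc : Continuous U := continuous_iff_continuousAt.2 fun t => (hd t).continuousAt
  have key : ∀ f : ℝ → ℝ, Continuous f →
      HasSum (fun i => ‖fourierCoeffOn hT (fun t => (f t : ℂ)) i‖ ^ 2)
        (T⁻¹ * ∫ x in (0 : ℝ)..T, f x ^ 2) := by
    intro f hf
    have hm : MemLp (fun t => (f t : ℂ)) 2 (volume.restrict (Ioc 0 T)) := by
      have hfc : Continuous (fun t => (f t : ℂ)) := Complex.continuous_ofReal.comp hf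
      have : MemLp (fun t => (f t : ℂ)) 2 (volume.restrict (Icc 0 T)) := by
        obtain ⟨C, hC⟩ := isCompact_Icc.exists_bound_of_continuousOn (s := Icc 0 T) hfc.continuousOn
        exact MemLp.of_bound hfc.aestronglyMeasurable C
          ((ae_restrict_iff' measurableSet_Icc).2 (Eventually.of_forall hC))
      exact this.mono_measure (Measure.restrict_mono Ioc_subset_Icc_self le_rfl)
    have := hasSum_sq_fourierCoeffOn hT hm
    simpa using this
  have h0 := key U hUc
  have h1 := key U' hc
  have hle := hasSum_le (fun i => ?_) (h0.mul_left ((2 * Real.pi / T) ^ 2)) h1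
  · have h3 := mul_le_mul_of_nonneg_left hle hT.le
    have h4 : T * T⁻¹ = 1 := mul_inv_cancel₀ hT.ne'
    calc _ = T * T⁻¹ * ((2 * Real.pi / T) ^ 2 * ∫ t in (0 : ℝ)..T, U t ^ 2) := by rw [h4, one_mul]
      _ = T * ((2 * Real.pi / T) ^ 2 * (T⁻¹ * ∫ t in (0 : ℝ)..T, U t ^ 2)) := by ring
      _ ≤ T * (T⁻¹ * ∫ t in (0 : ℝ)..T, U' t ^ 2) := h3
      _ = T * T⁻¹ * ∫ t in (0 : ℝ)..T, U' t ^ 2 := by ring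
      _ = _ := by rw [h4, one_mul]
  · rcases eq_or_ne i 0 with rfl | hi
    · have : fourierCoeffOn hT (fun t => (U t : ℂ)) 0 = 0 := by
        rw [fourierCoeffOn_eq_integral]
        simp only [neg_zero, fourier_zero, one_smul]
        rw [intervalIntegral.integral_ofReal, hU]
        simp
      rw [this]
      simp
    · have hUT : U T = U 0 := by simpa using hper 0
      have := fourierCoeffOn_of_hasDerivAt (f := fun t => (U t : ℂ)) (f' := fun t => (U' t : ℂ))
        hT hi (fun t _ => (hd t).ofReal_comp)
        ((Complex.continuous_ofReal.comp hc).intervalIntegrable _ _)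
      rw [this, hUT]
      have hi1 : (1 : ℝ) ≤ |(i : ℝ)| := by exact_mod_cast Int.one_le_abs hi
      simp only [sub_self, mul_zero, zero_sub, Complex.ofReal_zero, sub_zero, norm_mul, norm_div, norm_neg,
        Complex.norm_real, Complex.norm_I, norm_one, Complex.norm_intCast, Real.norm_eq_abs,
        abs_of_pos hT, abs_of_pos Real.pi_pos, Complex.norm_ofNat]
      generalize ‖fourierCoeffOn hT (fun t => (U' t : ℂ)) i‖ = F
      have hpi := Real.pi_pos
      have : (2 * Real.pi / T) ^ 2 * (1 / (2 * Real.pi * 1 * |(i : ℝ)|) * (T * F)) ^ 2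
          = F ^ 2 * (1 / |(i : ℝ)|) ^ 2 := by
        have : |(i : ℝ)| ≠ 0 := by positivity
        field_simp
      rw [this]
      have h5 : 1 / |(i : ℝ)| ≤ 1 := by
        rw [div_le_one (by positivity)]
        exact hi1
      have h6 : (1 / |(i : ℝ)|) ^ 2 ≤ 1 := pow_le_one₀ (by positivity) h5
      nlinarith [sq_nonneg F]

/-- A mean-zero `U` vanishes somewhere in the period; integrate `U'` from that zero and apply
Cauchy–Schwarz. -/
theorem sq_le_mul_integral_deriv_sq {U U' : ℝ → ℝ} {T : ℝ} (hT : 0 < T)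
    (hper : Function.Periodic U T) (hd : ∀ t, HasDerivAt U (U' t) t) (hc : Continuous U')
    (hU : ∫ t in (0 : ℝ)..T, U t = 0) (t : ℝ) :
    U t ^ 2 ≤ T * ∫ s in (0 : ℝ)..T, U' s ^ 2 := by
  have hUc : Continuous U := continuous_iff_continuousAt.2 fun t => (hd t).continuousAt
  obtain ⟨z, hz, hz0⟩ : ∃ z ∈ Icc 0 T, U z = 0 := by
    by_contra! hne
    have hconst : (∀ x ∈ Icc 0 T, 0 < U x) ∨ (∀ x ∈ Icc 0 T, U x < 0) := by
      by_contra! hcon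
      obtain ⟨⟨x, hx, hx0⟩, y, hy, hy0⟩ := hcon
      obtain ⟨w, hw, hw0⟩ := isPreconnected_Icc.intermediate_value hx hy hUc.continuousOn
        (show (0 : ℝ) ∈ Icc (U x) (U y) from ⟨hx0, hy0⟩)
      exact hne w hw hw0
    rcases hconst with h | h
    · exact (intervalIntegral_pos_of_pos_on (hUc.intervalIntegrable _ _)
        (fun x hx => h x (Ioo_subset_Icc_self hx)) hT).ne' hU
    · have := intervalIntegral_pos_of_pos_on (hUc.neg.intervalIntegrable 0 T)
        (fun x hx => neg_pos.2 (h x (Ioo_subset_Icc_self hx))) hT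
      simp [intervalIntegral.integral_neg, hU] at this
  obtain ⟨r, hr, hrt⟩ := hper.exists_mem_Ico₀ hT t
  rw [hrt]
  set I := ∫ s in (0 : ℝ)..T, |U' s| with hI
  have hint : ∀ x y, IntervalIntegrable (fun s => |U' s|) volume x y :=
    fun x y => hc.abs.intervalIntegrable x y
  have h1 : |U r| ≤ I := by
    have e : ∫ s in z..r, U' s = U r := by
      rw [integral_eq_sub_of_hasDerivAt (fun t _ => hd t) (hc.intervalIntegrable _ _), hz0, sub_zero]
    rw [← e]
    have habs : |∫ s in z..r, U' s| ≤ |(∫ s in z..r, (|U' s|))| := by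
      simpa using norm_integral_le_abs_integral_norm (f := U') (a := z) (b := r) (μ := volume)
    refine habs.trans ?_
    refine abs_integral_mono_interval ?_ ?_ (hint 0 T) |>.trans (le_of_eq (abs_of_nonneg ?_))
    · rw [uIoc_of_le hT.le]
      rintro x hx
      rcases le_total z r with h | h
      · rw [uIoc_of_le h] at hx
        exact ⟨hz.1.trans_lt hx.1, hx.2.trans hr.2.le⟩
      · rw [uIoc_of_ge h] at hx
        exact ⟨hr.1.trans_lt hx.1, hx.2.trans hz.2⟩
    · exact Eventually.of_forall fun s => abs_nonneg _
    · exact integral_nonneg hT.le fun s _ => abs_nonneg _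
  -- Cauchy–Schwarz, read off from the nonnegative variance of `|U'|`.
  have h2 : I ^ 2 ≤ T * ∫ s in (0 : ℝ)..T, U' s ^ 2 := by
    have h3 : 0 ≤ ∫ s in (0 : ℝ)..T, (|U' s| - I / T) ^ 2 :=
      integral_nonneg hT.le fun s _ => sq_nonneg _
    have h4 : ∫ s in (0 : ℝ)..T, (|U' s| - I / T) ^ 2
        = (∫ s in (0 : ℝ)..T, U' s ^ 2) - 2 * (I / T) * I + T * (I / T) ^ 2 := by
      have : ∀ s, (|U' s| - I / T) ^ 2 = U' s ^ 2 - 2 * (I / T) * |U' s| + (I / T) ^ 2 := fun s => by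
        rw [sub_sq, sq_abs]; ring
      simp only [this]
      rw [intervalIntegral.integral_add, intervalIntegral.integral_sub,
        intervalIntegral.integral_const_mul, intervalIntegral.integral_const, smul_eq_mul, sub_zero]
      all_goals exact Continuous.intervalIntegrable (by fun_prop) _ _
    rw [h4] at h3
    have h5 : T * ((∫ s in (0 : ℝ)..T, U' s ^ 2) - 2 * (I / T) * I + T * (I / T) ^ 2)
        = T * (∫ s in (0 : ℝ)..T, U' s ^ 2) - I ^ 2 := by
      field_simp; ring
    have := mul_nonneg hT.le h3
    linarith
  calc U r ^ 2 = |U r| ^ 2 := (sq_abs _).symm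
    _ ≤ I ^ 2 := by gcongr
    _ ≤ _ := h2

/-- The damping disappears from every energy identity, whatever the sign of `c`, since `U U'` is an
exact derivative. -/
theorem Function.Periodic.integral_mul_second_order {U U' U'' : ℝ → ℝ} {T : ℝ} (c : ℝ)
    (hper : Function.Periodic U T) (hper' : Function.Periodic U' T)
    (hd : ∀ t, HasDerivAt U (U' t) t)
    (hd' : ∀ t, HasDerivAt U' (U'' t) t) (hc : Continuous U'') :
    ∫ t in (0 : ℝ)..T, U t * (U'' t + c * U' t) = - ∫ t in (0 : ℝ)..T, U' t ^ 2 := by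
  have hUc : Continuous U := continuous_iff_continuousAt.2 fun t => (hd t).continuousAt
  have hUc' : Continuous U' := continuous_iff_continuousAt.2 fun t => (hd' t).continuousAt
  have h := Function.Periodic.integral_deriv_eq_zero (T := T)
    (f := fun t => U t * U' t + c / 2 * (U t * U t))
    (f' := fun t => (U' t * U' t + U t * U'' t) + c / 2 * (U' t * U t + U t * U' t))
    (fun t => by simp only [hper t, hper' t])
    (fun t => ((hd t).mul (hd' t)).add (((hd t).mul (hd t)).const_mul _)) (by fun_prop)
  have e : ∀ t, (U' t * U' t + U t * U'' t) + c / 2 * (U' t * U t + U t * U' t)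
      = U t * (U'' t + c * U' t) + U' t ^ 2 := fun t => by ring
  simp only [e] at h
  rw [intervalIntegral.integral_add (Continuous.intervalIntegrable (by fun_prop) _ _)
    (Continuous.intervalIntegrable (by fun_prop) _ _)] at h
  linarith

/-! ### Twice differentiable periodic functions -/

/-- `u` is a `T`-periodic function of class `C²` with derivatives `u'` and `u''`. -/
structure IsPeriodicJet (T : ℝ) (u u' u'' : ℝ → ℝ) : Prop where
  periodic : Function.Periodic u T
  hasDerivAt : ∀ t, HasDerivAt u (u' t) t
  hasDerivAt' : ∀ t, HasDerivAt u' (u'' t) t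
  cont'' : Continuous u''

namespace IsPeriodicJet

variable {T : ℝ} {u u' u'' v v' v'' : ℝ → ℝ}

theorem cont (h : IsPeriodicJet T u u' u'') : Continuous u :=
  continuous_iff_continuousAt.2 fun t => (h.hasDerivAt t).continuousAt

theorem cont' (h : IsPeriodicJet T u u' u'') : Continuous u' :=
  continuous_iff_continuousAt.2 fun t => (h.hasDerivAt' t).continuousAt

theorem deriv_eq (h : IsPeriodicJet T u u' u'') : deriv u = u' :=
  funext fun t => (h.hasDerivAt t).deriv

theorem deriv_eq' (h : IsPeriodicJet T u u' u'') : deriv u' = u'' :=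
  funext fun t => (h.hasDerivAt' t).deriv

theorem periodic' (h : IsPeriodicJet T u u' u'') : Function.Periodic u' T :=
  h.deriv_eq ▸ h.periodic.deriv_periodic

theorem contDiff (h : IsPeriodicJet T u u' u'') : ContDiff ℝ 2 u :=
  contDiff_two_of_hasDerivAt h.hasDerivAt h.hasDerivAt' h.cont''

theorem of_contDiff (h : ContDiff ℝ 2 u) (hp : Function.Periodic u T) :
    IsPeriodicJet T u (deriv u) (deriv (deriv u)) :=
  ⟨hp, h.hasDerivAt_of_two.1, h.hasDerivAt_of_two.2.1, h.hasDerivAt_of_two.2.2⟩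

theorem sub (h : IsPeriodicJet T u u' u'') (k : IsPeriodicJet T v v' v'') :
    IsPeriodicJet T (fun t => u t - v t) (fun t => u' t - v' t) (fun t => u'' t - v'' t) :=
  ⟨fun t => by simp only [h.periodic t, k.periodic t],
    fun t => (h.hasDerivAt t).sub (k.hasDerivAt t),
    fun t => (h.hasDerivAt' t).sub (k.hasDerivAt' t), h.cont''.sub k.cont''⟩

theorem add_const (h : IsPeriodicJet T u u' u'') (x : ℝ) :
    IsPeriodicJet T (fun t => u t + x) u' u'' :=
  ⟨fun t => by simp only [h.periodic t],
    fun t => (h.hasDerivAt t).add_const x, h.hasDerivAt', h.cont''⟩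

theorem integral_deriv (h : IsPeriodicJet T u u' u'') : ∫ t in (0 : ℝ)..T, u' t = 0 :=
  h.periodic.integral_deriv_eq_zero h.hasDerivAt h.cont'

theorem integral_deriv' (h : IsPeriodicJet T u u' u'') : ∫ t in (0 : ℝ)..T, u'' t = 0 :=
  h.periodic'.integral_deriv_eq_zero h.hasDerivAt' h.cont''

theorem integral_mul_second_order (h : IsPeriodicJet T u u' u'') (c : ℝ) :
    ∫ t in (0 : ℝ)..T, u t * (u'' t + c * u' t) = - ∫ t in (0 : ℝ)..T, u' t ^ 2 :=
  h.periodic.integral_mul_second_order c h.periodic' h.hasDerivAt h.hasDerivAt' h.cont''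

theorem wirtinger (h : IsPeriodicJet T u u' u'') (hT : 0 < T)
    (h0 : ∫ t in (0 : ℝ)..T, u t = 0) :
    (2 * Real.pi / T) ^ 2 * ∫ t in (0 : ℝ)..T, u t ^ 2 ≤ ∫ t in (0 : ℝ)..T, u' t ^ 2 :=
  wirtinger_inequality hT h.periodic h.hasDerivAt h.cont' h0

theorem sq_le (h : IsPeriodicJet T u u' u'') (hT : 0 < T)
    (h0 : ∫ t in (0 : ℝ)..T, u t = 0) (t : ℝ) :
    u t ^ 2 ≤ T * ∫ s in (0 : ℝ)..T, u' s ^ 2 :=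
  sq_le_mul_integral_deriv_sq hT h.periodic h.hasDerivAt h.cont' h0 t

end IsPeriodicJet

/-! ### Periodic solutions of linear equations -/

theorem exists_periodic_first_order {T r : ℝ} (hT : 0 < T) (hr : r ≠ 0) {f : ℝ → ℝ}
    (hf : Continuous f) (hfT : Function.Periodic f T) :
    ∃ v : ℝ → ℝ, Function.Periodic v T ∧ ∀ t, HasDerivAt v (r * v t + f t) t := by
  set P : ℝ → ℝ := fun t => ∫ s in (0 : ℝ)..t, Real.exp (-(r * s)) * f s with hP
  have hPd : ∀ t, HasDerivAt P (Real.exp (-(r * t)) * f t) t := fun t =>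
    (show Continuous fun s => Real.exp (-(r * s)) * f s by fun_prop).integral_hasStrictDerivAt 0 t
      |>.hasDerivAt
  have hne : 1 - Real.exp (r * T) ≠ 0 := by
    intro h
    have : Real.exp (r * T) = 1 := by linarith
    rw [Real.exp_eq_one_iff] at this
    exact (mul_ne_zero hr hT.ne') this
  -- Variation of constants, with `C` chosen so that `v T = v 0`.
  set C := Real.exp (r * T) * P T / (1 - Real.exp (r * T)) with hC
  have hEd : ∀ k t : ℝ, HasDerivAt (fun t => Real.exp (k * t)) (Real.exp (k * t) * k) t := fun k t =>
    by simpa using ((hasDerivAt_id t).const_mul k).exp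
  set v : ℝ → ℝ := fun t => Real.exp (r * t) * (C + P t) with hv
  have hvd : ∀ t, HasDerivAt v (r * v t + f t) t := by
    intro t
    refine ((hEd r t).mul ((hPd t).const_add C)).congr_deriv ?_
    have : Real.exp (r * t) * Real.exp (-(r * t)) = 1 := by rw [← Real.exp_add]; simp
    calc _ = r * v t + (Real.exp (r * t) * Real.exp (-(r * t))) * f t := by simp only [hv]; ring
      _ = _ := by rw [this, one_mul]
  refine ⟨v, fun t => ?_, hvd⟩
  -- `v (t + T) - v t` solves the homogeneous equation, so agreement at `t = 0` propagates to all
  -- `t`.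
  have hd : ∀ t, HasDerivAt (fun t => Real.exp (-r * t) * (v (t + T) - v t)) 0 t := by
    intro t
    refine ((hEd (-r) t).mul (((hvd (t + T)).comp_add_const t T).sub (hvd t))).congr_deriv ?_
    simp only [Pi.sub_apply, hfT t]
    ring
  have hcst := is_const_of_deriv_eq_zero (fun t => (hd t).differentiableAt)
    (fun t => (hd t).deriv) t 0
  have h0 : v (0 + T) - v 0 = 0 := by
    simp only [hv, hP, zero_add, mul_zero, Real.exp_zero, integral_same, add_zero, one_mul]
    change Real.exp (r * T) * (C + P T) - C = 0
    rw [hC]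
    field_simp
    ring
  rw [h0, mul_zero] at hcst
  have := (mul_eq_zero.1 hcst).resolve_left (Real.exp_pos _).ne'
  linarith

/-- Since `k > 0`, the characteristic roots are real and nonzero, so the operator factors into two
periodically solvable first-order ones. -/
theorem exists_periodic_second_order {T k : ℝ} (c : ℝ) (hT : 0 < T) (hk : 0 < k) {F : ℝ → ℝ}
    (hF : Continuous F) (hFT : Function.Periodic F T) :
    ∃ W W' W'' : ℝ → ℝ, IsPeriodicJet T W W' W'' ∧ ∀ t, W'' t + c * W' t - k * W t = - F t := by
  set s := Real.sqrt (c ^ 2 + 4 * k)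
  have hs : s ^ 2 = c ^ 2 + 4 * k := Real.sq_sqrt (by positivity)
  set r₁ := (-c + s) / 2 with h1
  set r₂ := (-c - s) / 2 with h2
  have hsum : r₁ + r₂ = -c := by rw [h1, h2]; ring
  have hprod : r₁ * r₂ = -k := by rw [h1, h2]; nlinarith
  have hr1 : r₁ ≠ 0 := by rintro h; rw [h] at hprod; linarith
  have hr2 : r₂ ≠ 0 := by rintro h; rw [h] at hprod; linarith
  obtain ⟨v, hvT, hv⟩ := exists_periodic_first_order (f := fun t => - F t) hT hr1 hF.neg
    (fun t => by simp only [hFT t])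
  have hvc : Continuous v := continuous_iff_continuousAt.2 fun t => (hv t).continuousAt
  obtain ⟨W, hWT, hW⟩ := exists_periodic_first_order hT hr2 hvc hvT
  have hWc : Continuous W := continuous_iff_continuousAt.2 fun t => (hW t).continuousAt
  refine ⟨W, fun t => r₂ * W t + v t, fun t => r₂ * (r₂ * W t + v t) + (r₁ * v t + - F t),
    ⟨hWT, hW, fun t => ((hW t).const_mul r₂).add (hv t), by fun_prop⟩, fun t => ?_⟩
  have hc : c = -(r₁ + r₂) := by linarith
  have hk' : k = -(r₁ * r₂) := by linarith
  rw [hc, hk']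
  ring

/-! ### Existence for Lipschitz monotone nonlinearities with prescribed average -/

/-- The contraction estimate for the iteration below. Testing with `W` removes `M`; Young's
inequality with equal weights on `F W` and Wirtinger's inequality then give an `L²` factor below
`1`, because `b < ω²`. The pointwise bound transfers `L²` smallness to the sup norm. -/
theorem IsPeriodicJet.resolvent_bound {T b c l : ℝ} (hT : 0 < T) (hb : 0 < b)
    (hbω : b < (2 * Real.pi / T) ^ 2) (hl : b ≤ l) {W W' W'' F V : ℝ → ℝ} {M : ℝ}
    (hW : IsPeriodicJet T W W' W'') (hW0 : ∫ t in (0 : ℝ)..T, W t = 0)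
    (hV : Continuous V) (hFV : ∀ t, |F t| ≤ l * |V t|)
    (heq : ∀ t, W'' t + c * W' t - (l - b) * W t = - (F t - M)) :
    (∫ t in (0 : ℝ)..T, W t ^ 2 ≤
        l / (l + 2 * ((2 * Real.pi / T) ^ 2 - b)) * ∫ t in (0 : ℝ)..T, V t ^ 2) ∧
      ∀ t, W t ^ 2 ≤ T * l * ∫ t in (0 : ℝ)..T, V t ^ 2 := by
  have hWc := hW.cont
  have hWc' := hW.cont'
  have hWc'' := hW.cont''
  have hw := hW.wirtinger hT hW0
  have h1 : ∫ t in (0 : ℝ)..T, W t * (W'' t + c * W' t)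
      ≥ ∫ t in (0 : ℝ)..T, ((l - b) * W t ^ 2 + M * W t - (l / 2 * V t ^ 2 + l / 2 * W t ^ 2)) := by
    refine integral_mono_on hT.le (Continuous.intervalIntegrable (by fun_prop) _ _)
      (Continuous.intervalIntegrable (by fun_prop) _ _) fun t _ => ?_
    have e : W t * (W'' t + c * W' t) = (l - b) * W t ^ 2 + M * W t - F t * W t := by
      linear_combination W t * heq t
    rw [e]
    have h2 : F t * W t ≤ l * |V t| * |W t| := by
      calc F t * W t ≤ |F t * W t| := le_abs_self _
        _ = |F t| * |W t| := abs_mul _ _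
        _ ≤ _ := by gcongr; exact hFV t
    have h3 : |V t| * |W t| ≤ (V t ^ 2 + W t ^ 2) / 2 := by
      have := sq_nonneg (|V t| - |W t|)
      rw [sub_sq, sq_abs, sq_abs] at this
      linarith
    have h4 := mul_le_mul_of_nonneg_left h3 (hb.le.trans hl)
    linarith
  rw [hW.integral_mul_second_order, intervalIntegral.integral_sub, intervalIntegral.integral_add,
    intervalIntegral.integral_add] at h1
  rotate_left
  any_goals exact Continuous.intervalIntegrable (by fun_prop) _ _
  simp only [intervalIntegral.integral_const_mul, hW0] at h1
  have hVn : 0 ≤ ∫ t in (0 : ℝ)..T, V t ^ 2 := integral_nonneg hT.le fun t _ => sq_nonneg _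
  have hWn : 0 ≤ ∫ t in (0 : ℝ)..T, W t ^ 2 := integral_nonneg hT.le fun t _ => sq_nonneg _
  set IV := ∫ t in (0 : ℝ)..T, V t ^ 2
  set IW := ∫ t in (0 : ℝ)..T, W t ^ 2
  set ID := ∫ t in (0 : ℝ)..T, W' t ^ 2
  set q := (2 * Real.pi / T) ^ 2
  have hlp : 0 < l := hb.trans_le hl
  have hden : 0 < l + 2 * (q - b) := by linarith
  have key : (l + 2 * (q - b)) * IW ≤ l * IV := by linarith
  refine ⟨?_, fun t => (hW.sq_le hT hW0 t).trans ?_⟩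
  · rw [div_mul_eq_mul_div, le_div_iff₀ hden]
    linarith
  · rw [mul_assoc]
    refine mul_le_mul_of_nonneg_left ?_ hT.le
    have h5 : IW ≤ IV := by
      by_contra! hlt
      nlinarith [mul_nonneg (by linarith : 0 ≤ q - b) hWn]
    nlinarith

/-- Add `l u` to both sides and iterate the resolvent on the mean-zero part `V = u - ξ`. Each step
is a contraction in `L²`; as one step also maps `L²` boundedly to the sup norm, a high iterate
contracts the complete space `C(AddCircle T, ℝ)`. -/
theorem exists_periodic_of_lipschitz {T b c ξ K : ℝ} {a e g : ℝ → ℝ} (hT : 0 < T)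
    (ha : Continuous a) (haT : Function.Periodic a T) (hapos : ∀ t, 0 < a t)
    (he : Continuous e) (heT : Function.Periodic e T)
    (hb : 0 < b) (hbω : b < (2 * Real.pi / T) ^ 2) (hg : Antitone g)
    (hK : 0 ≤ K) (hgK : ∀ x y, |g x - g y| ≤ K * |x - y|) :
    ∃ (μ : ℝ) (u u' u'' : ℝ → ℝ), IsPeriodicJet T u u' u'' ∧ (∫ t in (0 : ℝ)..T, u t = ξ * T) ∧
      ∀ t, u'' t + c * u' t + b * u t + a t * g (u t) = μ + e t := by
  have : Fact (0 < T) := ⟨hT⟩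
  obtain ⟨A, hA0, hA⟩ := haT.exists_abs_le_of_continuous hT ha
  have hgc : Continuous g := (LipschitzWith.of_dist_le_mul (K := ⟨K, hK⟩) hgK).continuous
  -- `A * K` dominates the Lipschitz constant of `a g`, so the difference quotients of `x ↦ l x + a
  -- g (ξ + x)` lie in `[0, l]`; the rest makes `l - b` positive.
  set l := A * K + b + 1 with hl
  have hAK : 0 ≤ A * K := mul_nonneg hA0 hK
  have hlb : 0 < l - b := by linarith
  let F : C(AddCircle T, ℝ) → ℝ → ℝ := fun V t => l * V (t : AddCircle T) +
    a t * g (ξ + V (t : AddCircle T)) - e t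
  have hmk : Continuous fun t : ℝ => (t : AddCircle T) := AddCircle.continuous_mk' T
  have hmkT : ∀ t : ℝ, ((t + T : ℝ) : AddCircle T) = t := fun t => AddCircle.coe_add_period T t
  have hVc : ∀ V : C(AddCircle T, ℝ), Continuous fun t : ℝ => V (t : AddCircle T) := fun V =>
    V.continuous.comp hmk
  have hFc : ∀ V, Continuous (F V) := fun V => by
    have := hVc V
    fun_prop
  have hFT : ∀ V, Function.Periodic (F V) T := fun V t => by
    simp only [F, hmkT, haT t, heT t]
  -- Subtracting the mean of `F V` forces the solution of the linear equation to have mean zero;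
  -- this mean becomes the multiplier.
  let M : C(AddCircle T, ℝ) → ℝ := fun V => (∫ t in (0 : ℝ)..T, F V t) / T
  have hsol : ∀ V, ∃ (S : C(AddCircle T, ℝ)) (W' W'' : ℝ → ℝ),
      IsPeriodicJet T (fun t : ℝ => S (t : AddCircle T)) W' W'' ∧
      (∫ t in (0 : ℝ)..T, S (t : AddCircle T) = 0) ∧
      ∀ t : ℝ, W'' t + c * W' t - (l - b) * S (t : AddCircle T) = - (F V t - M V) := by
    intro V
    obtain ⟨W, W', W'', hW, hWe⟩ := exists_periodic_second_order c hT hlb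
      ((hFc V).sub continuous_const) (F := fun t => F V t - M V)
      (fun t => by simp only [hFT V t])
    let S : C(AddCircle T, ℝ) := ⟨hW.periodic.lift, continuous_quot_lift _ hW.cont⟩
    have hS : ∀ t : ℝ, S (t : AddCircle T) = W t := fun t => hW.periodic.lift_coe t
    refine ⟨S, W', W'', by simpa only [hS] using hW, ?_, by simpa only [hS] using hWe⟩
    simp only [hS]
    have hWc := hW.cont
    have hWc' := hW.cont'
    have hWc'' := hW.cont''
    have hFcV := hFc V
    have h1 : ∫ t in (0 : ℝ)..T, (W'' t + c * W' t - (l - b) * W t)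
        = ∫ t in (0 : ℝ)..T, -(F V t - M V) := by simp only [hWe]
    rw [intervalIntegral.integral_sub, intervalIntegral.integral_add, intervalIntegral.integral_neg,
      intervalIntegral.integral_sub] at h1
    rotate_left
    any_goals exact Continuous.intervalIntegrable (by fun_prop) _ _
    simp only [intervalIntegral.integral_const_mul, hW.integral_deriv, hW.integral_deriv',
      intervalIntegral.integral_const, smul_eq_mul, M] at h1
    have h2 : (T - 0) * ((∫ t in (0 : ℝ)..T, F V t) / T) = ∫ t in (0 : ℝ)..T, F V t := by
      field_simp; ring
    rw [h2] at h1
    have h3 : (l - b) * ∫ t in (0 : ℝ)..T, W t = 0 := by linarith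
    exact (mul_eq_zero.1 h3).resolve_left hlb.ne'
  choose S S' S'' hS hS0 hSe using hsol
  let N : C(AddCircle T, ℝ) → C(AddCircle T, ℝ) → ℝ := fun V₁ V₂ =>
    ∫ t in (0 : ℝ)..T, (V₁ (t : AddCircle T) - V₂ (t : AddCircle T)) ^ 2
  set ρ := l / (l + 2 * ((2 * Real.pi / T) ^ 2 - b)) with hρ
  have hlp : 0 < l := by linarith
  have hρ0 : 0 ≤ ρ := div_nonneg hlp.le (by linarith)
  have hρ1 : ρ < 1 := by
    rw [hρ, div_lt_one (by linarith)]
    linarith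
  have hstep : ∀ V₁ V₂, N (S V₁) (S V₂) ≤ ρ * N V₁ V₂ ∧
      ∀ t : ℝ, (S V₁ (t : AddCircle T) - S V₂ (t : AddCircle T)) ^ 2 ≤ T * l * N V₁ V₂ := by
    intro V₁ V₂
    refine ((hS V₁).sub (hS V₂)).resolvent_bound (c := c) (F := fun t => F V₁ t - F V₂ t)
      (V := fun t => V₁ (t : AddCircle T) - V₂ (t : AddCircle T)) (M := M V₁ - M V₂)
      hT hb hbω (by linarith) ?_ ?_ ?_ ?_
    · rw [intervalIntegral.integral_sub ((hVc _).intervalIntegrable _ _)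
        ((hVc _).intervalIntegrable _ _), hS0, hS0, sub_zero]
    · exact (hVc V₁).sub (hVc V₂)
    · intro t
      set x := V₁ (t : AddCircle T)
      set y := V₂ (t : AddCircle T)
      have e : F V₁ t - F V₂ t = l * (x - y) + a t * (g (ξ + x) - g (ξ + y)) := by
        simp only [F, x, y]; ring
      rw [e]
      have hG : |a t * (g (ξ + x) - g (ξ + y))| ≤ l * |x - y| := by
        rw [abs_mul]
        have h1 := hgK (ξ + x) (ξ + y)
        rw [add_sub_add_left_eq_sub] at h1
        calc |a t| * |g (ξ + x) - g (ξ + y)| ≤ A * (K * |x - y|) := by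
              gcongr
              exact hA t
          _ = A * K * |x - y| := by ring
          _ ≤ l * |x - y| := by gcongr; linarith
      rcases le_total x y with h | h
      · have h2 : 0 ≤ a t * (g (ξ + x) - g (ξ + y)) :=
          mul_nonneg (hapos t).le (sub_nonneg.2 (hg (by linarith)))
        rw [abs_of_nonneg h2] at hG
        rw [abs_of_nonpos (sub_nonpos.2 h)] at hG ⊢
        have h3 := mul_nonneg hlp.le (sub_nonneg.2 h)
        rw [abs_le]
        constructor <;> linarith
      · have h2 : a t * (g (ξ + x) - g (ξ + y)) ≤ 0 :=
          mul_nonpos_of_nonneg_of_nonpos (hapos t).le (sub_nonpos.2 (hg (by linarith)))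
        rw [abs_of_nonpos h2] at hG
        rw [abs_of_nonneg (sub_nonneg.2 h)] at hG ⊢
        have h3 := mul_nonneg hlp.le (sub_nonneg.2 h)
        rw [abs_le]
        constructor <;> linarith
    · intro t
      linear_combination hSe V₁ t - hSe V₂ t
  have hiter : ∀ (n : ℕ) (V₁ V₂ : C(AddCircle T, ℝ)),
      N (S^[n] V₁) (S^[n] V₂) ≤ ρ ^ n * N V₁ V₂ := by
    intro n V₁ V₂
    induction n with
    | zero => simp
    | succ n ih =>
      rw [Function.iterate_succ_apply', Function.iterate_succ_apply', pow_succ']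
      refine (hstep _ _).1.trans ?_
      rw [mul_assoc]
      gcongr
  have hNd : ∀ V₁ V₂, N V₁ V₂ ≤ T * dist V₁ V₂ ^ 2 := by
    intro V₁ V₂
    have hc : Continuous fun t : ℝ => (V₁ (t : AddCircle T) - V₂ (t : AddCircle T)) ^ 2 :=
      ((hVc V₁).sub (hVc V₂)).pow 2
    have := integral_mono_on hT.le (hc.intervalIntegrable 0 T)
      (intervalIntegrable_const (μ := volume) (c := dist V₁ V₂ ^ 2)) fun t _ => by
        rw [← sq_abs, ← Real.dist_eq]
        gcongr
        exact V₁.dist_apply_le_dist _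
    simpa using this
  -- The bound controls squared distances, so `1 / 4` here gives Lipschitz constant `1 / 2`.
  obtain ⟨n, hn⟩ : ∃ n : ℕ, T ^ 2 * l * ρ ^ n ≤ 1 / 4 := by
    have h1 : Tendsto (fun n : ℕ => T ^ 2 * l * ρ ^ n) atTop (𝓝 (T ^ 2 * l * 0)) :=
      (tendsto_pow_atTop_nhds_zero_of_lt_one hρ0 hρ1).const_mul _
    rw [mul_zero] at h1
    exact (h1.eventually (eventually_le_nhds (by norm_num))).exists
  have hcon : ContractingWith (1 / 2) S^[n + 1] := by
    refine ⟨by rw [← NNReal.coe_lt_coe]; norm_num, LipschitzWith.of_dist_le_mul fun V₁ V₂ => ?_⟩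
    rw [ContinuousMap.dist_le (by positivity)]
    intro x
    obtain ⟨t, rfl⟩ := QuotientAddGroup.mk_surjective x
    rw [Function.iterate_succ_apply', Function.iterate_succ_apply', Real.dist_eq]
    refine abs_le_of_sq_le_sq ?_ (by positivity)
    calc _ ≤ T * l * N (S^[n] V₁) (S^[n] V₂) := (hstep _ _).2 t
      _ ≤ T * l * (ρ ^ n * (T * dist V₁ V₂ ^ 2)) := by
        gcongr
        exact (hiter n V₁ V₂).trans (by gcongr; exact hNd V₁ V₂)
      _ = T ^ 2 * l * ρ ^ n * dist V₁ V₂ ^ 2 := by ring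
      _ ≤ 1 / 4 * dist V₁ V₂ ^ 2 := by gcongr
      _ = _ := by push_cast; ring
  have hfix := hcon.isFixedPt_fixedPoint_iterate
  set V := ContractingWith.fixedPoint S^[n + 1] hcon
  have hVS : S V = V := hfix
  have hj := hS V
  have h0 := hS0 V
  have hE := hSe V
  rw [hVS] at hj h0 hE
  -- Passing from `V` to `u = V + ξ` adds `b ξ` to the left-hand side.
  refine ⟨M V + b * ξ, _, S' V, S'' V, hj.add_const ξ, ?_, fun t => ?_⟩
  · rw [intervalIntegral.integral_add ((hVc V).intervalIntegrable _ _) (by simp), h0]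
    simp [mul_comm]
  · have := hE t
    simp only [F] at this
    rw [add_comm ξ] at this
    linarith

/-! ### A priori bounds and existence for the singular equation -/

/-- If `u'' s < 0`, then `s` would also be a local maximum, making `u` locally constant and `u'' s =
0`. -/
theorem second_deriv_nonneg_of_forall_le {u u' u'' : ℝ → ℝ} {s : ℝ}
    (h1 : ∀ t, HasDerivAt u (u' t) t) (h2 : ∀ t, HasDerivAt u' (u'' t) t)
    (hs : ∀ t, u s ≤ u t) : u' s = 0 ∧ 0 ≤ u'' s := by
  have hmin : IsLocalMin u s := Eventually.of_forall hs
  have e1 : deriv u = u' := funext fun t => (h1 t).deriv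
  have e2 : deriv u' = u'' := funext fun t => (h2 t).deriv
  have h0 : u' s = 0 := hmin.hasDerivAt_eq_zero (h1 s)
  refine ⟨h0, ?_⟩
  by_contra! hneg
  have hmax : IsLocalMax u s := isLocalMax_of_deriv_deriv_neg (by rwa [e1, e2]) (by rwa [e1])
    (h1 s).continuousAt
  have heq : u =ᶠ[𝓝 s] fun _ => u s := hmax.mono fun t ht => le_antisymm ht (hs t)
  have := heq.deriv.deriv_eq
  simp only [deriv_const', e1, e2, deriv_const] at this
  linarith

theorem abs_rpow_neg_sub_le {p δ x y : ℝ} (hp : 0 < p) (hδ : 0 < δ) (hx : δ ≤ x) (hy : δ ≤ y) :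
    |x ^ (-p) - y ^ (-p)| ≤ p * δ ^ (-p - 1) * |x - y| := by
  have := Convex.norm_image_sub_le_of_norm_hasDerivWithin_le (s := Ici δ)
    (f := fun z : ℝ => z ^ (-p)) (f' := fun z => -p * z ^ (-p - 1)) (C := p * δ ^ (-p - 1))
    (fun z hz => (Real.hasDerivAt_rpow_const (Or.inl (hδ.trans_le hz).ne')).hasDerivWithinAt)
    (fun z hz => by
      have hz0 : 0 < z := hδ.trans_le hz
      rw [norm_mul, norm_neg, Real.norm_eq_abs, Real.norm_eq_abs, abs_of_pos hp,
        abs_of_pos (Real.rpow_pos_of_pos hz0 _)]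
      exact mul_le_mul_of_nonneg_left (Real.rpow_le_rpow_of_nonpos hδ hz (by linarith)) hp.le)
    (convex_Ici δ) hy hx
  simpa only [Real.norm_eq_abs] using this

theorem antitone_rpow_neg_max {p δ : ℝ} (hp : 0 < p) (hδ : 0 < δ) :
    Antitone fun x : ℝ => (max x δ) ^ (-p) := fun _ _ h =>
  Real.rpow_le_rpow_of_nonpos (hδ.trans_le (le_max_right _ _)) (max_le_max_right _ h) (by linarith)

/-- Test with `u - ξ`. Here `h` stands for the singular term and is bounded only where `u ≥ ξ`;
elsewhere `h (u - ξ) ≤ 0` has the favourable sign. The constants therefore do not see the size of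
`h` near the singularity, and the same identity controls `h` in a weighted `L¹` norm. -/
theorem IsPeriodicJet.apriori_bound {T b c ξ μ H E : ℝ} {u u' u'' h e : ℝ → ℝ} (hT : 0 < T)
    (hb : 0 < b) (hbω : b < (2 * Real.pi / T) ^ 2) (hu : IsPeriodicJet T u u' u'')
    (huξ : ∫ t in (0 : ℝ)..T, u t = ξ * T) (hh : Continuous h) (hh0 : ∀ t, 0 ≤ h t)
    (he : Continuous e) (hE : ∀ t, |e t| ≤ E) (hH0 : 0 ≤ H)
    (hH : ∀ t, ξ ≤ u t → h t ≤ H) (heq : ∀ t, u'' t + c * u' t + b * u t + h t = μ + e t) :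
    (∀ t, |u t - ξ| ≤ T ^ 2 * (H + E) * ((2 * Real.pi / T) ^ 2 / ((2 * Real.pi / T) ^ 2 - b))) ∧
    ∫ t in (0 : ℝ)..T, h t * |u t - ξ| ≤ T * (2 * H + E) *
      (T ^ 2 * (H + E) * ((2 * Real.pi / T) ^ 2 / ((2 * Real.pi / T) ^ 2 - b))) := by
  set q := (2 * Real.pi / T) ^ 2
  set R := T ^ 2 * (H + E) * (q / (q - b)) with hR
  have hU := hu.add_const (-ξ)
  simp only [← sub_eq_add_neg] at hU
  have huc := hu.cont
  have huc' := hu.cont'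
  have huc'' := hu.cont''
  have hU0 : ∫ t in (0 : ℝ)..T, (u t - ξ) = 0 := by
    rw [intervalIntegral.integral_sub (huc.intervalIntegrable _ _) (by simp), huξ]
    simp [mul_comm]
  have hE0 : 0 ≤ E := (abs_nonneg _).trans (hE 0)
  have hqb : 0 < q - b := sub_pos.2 hbω
  have hq : 0 < q := hb.trans hbω
  obtain ⟨t₀, ht₀⟩ := Function.Periodic.exists_forall_ge_of_continuous (f := fun t => |u t - ξ|) hT
    (fun t => by simp only [hu.periodic t]) (by fun_prop)
  set s := |u t₀ - ξ| with hs
  have hs0 : 0 ≤ s := abs_nonneg _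
  have hw := hU.wirtinger hT hU0
  have hsup := hU.sq_le hT hU0 t₀
  rw [← sq_abs, ← hs] at hsup
  have hen := hU.integral_mul_second_order c
  have e1 : ∀ t, (u t - ξ) * (u'' t + c * u' t)
      = (μ - b * ξ) * (u t - ξ) + e t * (u t - ξ) - b * (u t - ξ) ^ 2 - h t * (u t - ξ) := fun t => by
    linear_combination (u t - ξ) * heq t
  simp only [e1] at hen
  rw [intervalIntegral.integral_sub, intervalIntegral.integral_sub,
    intervalIntegral.integral_add] at hen
  rotate_left
  any_goals exact Continuous.intervalIntegrable (by fun_prop) _ _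
  simp only [intervalIntegral.integral_const_mul, hU0, mul_zero, zero_add] at hen
  have habs : ∫ t in (0 : ℝ)..T, |u t - ξ| ≤ s * T := by
    have := integral_mono_on hT.le (Continuous.intervalIntegrable (by fun_prop) 0 T)
      (intervalIntegrable_const (μ := volume) (c := s)) fun t _ => ht₀ t
    simpa [mul_comm] using this
  have habs0 : 0 ≤ ∫ t in (0 : ℝ)..T, |u t - ξ| := integral_nonneg hT.le fun t _ => abs_nonneg _
  have heU : |(∫ t in (0 : ℝ)..T, e t * (u t - ξ))| ≤ E * (∫ t in (0 : ℝ)..T, (|u t - ξ|)) := by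
    rw [← intervalIntegral.integral_const_mul]
    refine (abs_integral_le_integral_abs hT.le).trans ?_
    refine integral_mono_on hT.le (Continuous.intervalIntegrable (by fun_prop) _ _)
      (Continuous.intervalIntegrable (by fun_prop) _ _) fun t _ => ?_
    rw [abs_mul]
    gcongr
    exact hE t
  have hpt : ∀ t, h t * (u t - ξ) ≤ H * |u t - ξ| ∧
      h t * |u t - ξ| ≤ 2 * H * |u t - ξ| - h t * (u t - ξ) := by
    intro t
    rcases le_total ξ (u t) with hle | hle
    · rw [abs_of_nonneg (sub_nonneg.2 hle)]
      have := mul_le_mul_of_nonneg_right (hH t hle) (sub_nonneg.2 hle)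
      constructor <;> linarith
    · rw [abs_of_nonpos (sub_nonpos.2 hle)]
      have h1 := mul_nonneg (hh0 t) (sub_nonneg.2 hle)
      have h2 := mul_nonneg hH0 (sub_nonneg.2 hle)
      constructor <;> linarith
  have hhU : ∫ t in (0 : ℝ)..T, h t * (u t - ξ) ≤ H * ∫ t in (0 : ℝ)..T, |u t - ξ| := by
    rw [← intervalIntegral.integral_const_mul]
    exact integral_mono_on hT.le (Continuous.intervalIntegrable (by fun_prop) _ _)
      (Continuous.intervalIntegrable (by fun_prop) _ _) fun t _ => (hpt t).1
  have hhU' : ∫ t in (0 : ℝ)..T, h t * |u t - ξ| ≤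
      2 * H * (∫ t in (0 : ℝ)..T, |u t - ξ|) - ∫ t in (0 : ℝ)..T, h t * (u t - ξ) := by
    rw [← intervalIntegral.integral_const_mul, ← intervalIntegral.integral_sub
      (Continuous.intervalIntegrable (by fun_prop) _ _)
      (Continuous.intervalIntegrable (by fun_prop) _ _)]
    exact integral_mono_on hT.le (Continuous.intervalIntegrable (by fun_prop) _ _)
      (Continuous.intervalIntegrable (by fun_prop) _ _) fun t _ => (hpt t).2
  have hI2 : 0 ≤ ∫ t in (0 : ℝ)..T, (u t - ξ) ^ 2 := integral_nonneg hT.le fun t _ => sq_nonneg _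
  set ID := ∫ t in (0 : ℝ)..T, u' t ^ 2
  set I2 := ∫ t in (0 : ℝ)..T, (u t - ξ) ^ 2
  set I1 := ∫ t in (0 : ℝ)..T, |u t - ξ|
  set IE := ∫ t in (0 : ℝ)..T, e t * (u t - ξ)
  set IH := ∫ t in (0 : ℝ)..T, h t * (u t - ξ)
  obtain ⟨hE1, hE2⟩ := abs_le.1 heU
  have hsR : s ≤ R := by
    have h1 : (q - b) * ID ≤ q * ((H + E) * (s * T)) := by
      have h2 : ID ≤ b * I2 + (H + E) * (s * T) := by
        have := mul_le_mul_of_nonneg_left habs (add_nonneg hH0 hE0)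
        linarith
      have h3 := mul_le_mul_of_nonneg_left hw hb.le
      have h4 := mul_le_mul_of_nonneg_left h2 hq.le
      linarith
    have h5 : ID ≤ q * ((H + E) * (s * T)) / (q - b) := by
      rw [le_div_iff₀ hqb]; linarith
    have h6 : s ^ 2 ≤ R * s := by
      calc s ^ 2 ≤ T * ID := hsup
        _ ≤ T * (q * ((H + E) * (s * T)) / (q - b)) := by gcongr
        _ = R * s := by rw [hR]; ring
    rcases hs0.eq_or_lt with h0 | h0
    · rw [← h0]; positivity
    · rw [sq] at h6
      exact le_of_mul_le_mul_right h6 h0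
  refine ⟨fun t => (ht₀ t).trans hsR, hhU'.trans ?_⟩
  have h1 : -(E * I1) ≤ IH := by
    have h3 := mul_le_mul_of_nonneg_left hw hb.le
    have : b * I2 ≤ q * I2 := by gcongr
    linarith
  calc 2 * H * I1 - IH ≤ (2 * H + E) * I1 := by linarith
    _ ≤ (2 * H + E) * (R * T) := by
      gcongr
      exact habs.trans (by gcongr)
    _ = _ := by ring

/-- The integral of `h` equals `T (μ - b ξ)`, so an `L¹` bound on the singular term bounds `μ - b
ξ`; the equation at the minimum of `u` then bounds `h` there. The point is that `m` depends neither
on `δ ≤ m` nor on `ξ ≥ x`, which serves both existence and local uniformity. -/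
theorem IsPeriodicJet.exists_lower_bound {T p b c x : ℝ} {a e : ℝ → ℝ} (hT : 0 < T) (hp : 0 < p)
    (ha : Continuous a) (haT : Function.Periodic a T) (hapos : ∀ t, 0 < a t)
    (he : Continuous e) (heT : Function.Periodic e T) (hemean : ∫ t in (0 : ℝ)..T, e t = 0)
    (hb : 0 < b) (hbω : b < (2 * Real.pi / T) ^ 2) (hx : 0 < x) :
    ∃ m, 0 < m ∧ ∀ (δ ξ μ : ℝ) (u u' u'' : ℝ → ℝ), 0 < δ → δ ≤ m → x ≤ ξ →
      IsPeriodicJet T u u' u'' → (∫ t in (0 : ℝ)..T, u t = ξ * T) →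
      (∀ t, u'' t + c * u' t + b * u t + a t * (max (u t) δ) ^ (-p) = μ + e t) →
      ∀ t, m ≤ u t := by
  obtain ⟨A, hA0, hA⟩ := haT.exists_abs_le_of_continuous hT ha
  obtain ⟨E, hE0, hE⟩ := heT.exists_abs_le_of_continuous hT he
  obtain ⟨sa, hsa⟩ := haT.exists_forall_le_of_continuous hT ha
  have ha0 := hapos sa
  set H := A * (x / 2) ^ (-p) with hHdef
  have hH0 : 0 ≤ H := by positivity
  set R := T ^ 2 * (H + E) * ((2 * Real.pi / T) ^ 2 / ((2 * Real.pi / T) ^ 2 - b)) with hRdef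
  have hR0 : 0 ≤ R := by
    have := sub_pos.2 hbω
    positivity
  set M := H + 2 / x * ((2 * H + E) * R) + E + b * R with hM
  have hM0 : 0 ≤ M := by positivity
  -- Chosen so that a minimum below `m` would force `h ≥ M + 1` there, against the bound `M`.
  set m := ((M + 1) / a sa) ^ (-p)⁻¹ with hm
  have hm0 : 0 < m := by positivity
  have hmp : a sa * m ^ (-p) = M + 1 := by
    rw [hm, Real.rpow_inv_rpow (by positivity) (by linarith)]
    field_simp
  refine ⟨m, hm0, fun δ ξ μ u u' u'' hδ hδm hξ hu huξ heq => ?_⟩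
  have hξ0 : 0 < ξ := hx.trans_le hξ
  have huc := hu.cont
  have huc' := hu.cont'
  have huc'' := hu.cont''
  set h : ℝ → ℝ := fun t => a t * (max (u t) δ) ^ (-p) with hh
  have hpos : ∀ t, 0 < max (u t) δ := fun t => hδ.trans_le (le_max_right _ _)
  have hhc : Continuous h := ha.mul ((huc.max continuous_const).rpow_const fun t =>
    Or.inl (hpos t).ne')
  have hh0 : ∀ t, 0 ≤ h t := fun t => mul_nonneg (hapos t).le (Real.rpow_nonneg (hpos t).le _)
  have hhH : ∀ t, ξ / 2 ≤ u t → h t ≤ H := by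
    intro t ht
    refine mul_le_mul ((le_abs_self _).trans (hA t)) ?_ (Real.rpow_nonneg (hpos t).le _) hA0
    exact Real.rpow_le_rpow_of_nonpos (by positivity)
      ((by linarith : x / 2 ≤ u t).trans (le_max_left _ _)) (by linarith)
  obtain ⟨hb1, hb2⟩ := hu.apriori_bound hT hb hbω huξ hhc hh0 he hE hH0
    (fun t ht => hhH t (by linarith)) heq
  rw [← hRdef] at hb1 hb2
  have hint : ∫ t in (0 : ℝ)..T, h t = T * (μ - b * ξ) := by
    have h1 : ∫ t in (0 : ℝ)..T, h t
        = ∫ t in (0 : ℝ)..T, (μ + e t - (u'' t + c * u' t + b * u t)) :=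
      integral_congr fun t _ => by have := heq t; simp only [hh]; linarith
    rw [h1, intervalIntegral.integral_sub, intervalIntegral.integral_add,
      intervalIntegral.integral_add, intervalIntegral.integral_add]
    rotate_left
    any_goals exact Continuous.intervalIntegrable (by fun_prop) _ _
    simp only [intervalIntegral.integral_const_mul, hu.integral_deriv, hu.integral_deriv', hemean,
      huξ, intervalIntegral.integral_const, smul_eq_mul]
    ring
  -- Where `u ≥ ξ / 2`, `h` is at most `H`; elsewhere `|u - ξ| ≥ x / 2`, so the weighted bound
  -- applies.
  have hint2 : ∫ t in (0 : ℝ)..T, h t ≤ T * H + 2 / x * (T * (2 * H + E) * R) := by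
    have h1 : ∫ t in (0 : ℝ)..T, h t ≤ ∫ t in (0 : ℝ)..T, (H + 2 / x * (h t * |u t - ξ|)) := by
      refine integral_mono_on hT.le (hhc.intervalIntegrable _ _)
        (Continuous.intervalIntegrable (by fun_prop) _ _) fun t _ => ?_
      rcases le_total (ξ / 2) (u t) with hle | hle
      · have := mul_nonneg (hh0 t) (abs_nonneg (u t - ξ))
        have h2 : 0 ≤ 2 / x * (h t * |u t - ξ|) := by positivity
        linarith [hhH t hle]
      · have h2 : x / 2 ≤ |u t - ξ| := by
          rw [abs_of_nonpos (by linarith)]; linarith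
        have h3 : h t = 2 / x * (h t * (x / 2)) := by field_simp
        have h4 : 2 / x * (h t * (x / 2)) ≤ 2 / x * (h t * |u t - ξ|) := by
          gcongr
          exact hh0 t
        linarith
    rw [intervalIntegral.integral_add (intervalIntegrable_const (μ := volume))
      (Continuous.intervalIntegrable (by fun_prop) _ _), intervalIntegral.integral_const (c := H),
      smul_eq_mul, sub_zero] at h1
    have : 2 / x * (∫ t in (0 : ℝ)..T, h t * |u t - ξ|) ≤ 2 / x * (T * (2 * H + E) * R) := by
      gcongr
    rw [intervalIntegral.integral_const_mul] at h1
    linarith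
  have hμ : μ - b * ξ ≤ H + 2 / x * ((2 * H + E) * R) := by
    rw [hint] at hint2
    have : T * (μ - b * ξ) ≤ T * (H + 2 / x * ((2 * H + E) * R)) := by linarith
    exact le_of_mul_le_mul_left this hT
  obtain ⟨s, hs⟩ := hu.periodic.exists_forall_le_of_continuous hT huc
  obtain ⟨hs1, hs2⟩ := second_deriv_nonneg_of_forall_le hu.hasDerivAt hu.hasDerivAt' hs
  have hsM : h s ≤ M := by
    have h1 := heq s
    rw [hs1] at h1
    have h2 := (abs_le.1 (hb1 s)).1
    have h3 := mul_le_mul_of_nonneg_left h2 hb.le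
    have h4 := (abs_le.1 (hE s)).2
    simp only [hh]
    linarith
  intro t
  refine le_trans ?_ (hs t)
  by_contra! hlt
  have h1 : m ^ (-p) ≤ (max (u s) δ) ^ (-p) :=
    Real.rpow_le_rpow_of_nonpos (hpos s) (max_le hlt.le hδm) (by linarith)
  have h2 : a sa * m ^ (-p) ≤ h s :=
    mul_le_mul (hsa s) h1 (Real.rpow_nonneg hm0.le _) (hapos s).le
  linarith

theorem periodAverage_eq_iff {T ξ : ℝ} {u : ℝ → ℝ} (hT : 0 < T) :
    periodAverage T u = ξ ↔ ∫ t in (0 : ℝ)..T, u t = ξ * T := by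
  rw [periodAverage, one_div, inv_mul_eq_div, div_eq_iff hT.ne']

namespace IsPosPeriodicSol

variable {T p b c x μ : ℝ} {a e u : ℝ → ℝ}

theorem jet (h : IsPosPeriodicSol T p b c a e μ u) :
    IsPeriodicJet T u (deriv u) (deriv (deriv u)) := .of_contDiff h.contDiff h.periodic

theorem eqn_rpow_neg (h : IsPosPeriodicSol T p b c a e μ u) (t : ℝ) :
    deriv (deriv u) t + c * deriv u t + b * u t + a t * u t ^ (-p) = μ + e t := by
  rw [Real.rpow_neg (h.pos t).le, ← div_eq_mul_inv]
  exact h.eqn t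

theorem of_jet {u' u'' : ℝ → ℝ} (hu : IsPeriodicJet T u u' u'') (hpos : ∀ t, 0 < u t)
    (heq : ∀ t, u'' t + c * u' t + b * u t + a t * u t ^ (-p) = μ + e t) :
    IsPosPeriodicSol T p b c a e μ u := by
  refine ⟨hu.contDiff, hu.periodic, hpos, fun t => ?_⟩
  rw [hu.deriv_eq, hu.deriv_eq', div_eq_mul_inv, ← Real.rpow_neg (hpos t).le]
  exact heq t

theorem periodAverage_pos (h : IsPosPeriodicSol T p b c a e μ u) (hT : 0 < T) :
    0 < periodAverage T u :=
  mul_pos (by positivity) (intervalIntegral_pos_of_pos_on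
    (h.jet.cont.intervalIntegrable _ _) (fun t _ => h.pos t) hT)

end IsPosPeriodicSol

theorem exists_isPosPeriodicSol {T p b c ξ : ℝ} {a e : ℝ → ℝ} (hT : 0 < T) (hp : 0 < p)
    (ha : Continuous a) (haT : Function.Periodic a T) (hapos : ∀ t, 0 < a t)
    (he : Continuous e) (heT : Function.Periodic e T) (hemean : ∫ t in (0 : ℝ)..T, e t = 0)
    (hb : 0 < b) (hbω : b < (2 * Real.pi / T) ^ 2) (hξ : 0 < ξ) :
    ∃ (μ : ℝ) (u : ℝ → ℝ), IsPosPeriodicSol T p b c a e μ u ∧ periodAverage T u = ξ := by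
  obtain ⟨m, hm, hlow⟩ := IsPeriodicJet.exists_lower_bound (c := c) hT hp ha haT hapos he heT
    hemean hb hbω hξ
  obtain ⟨μ, u, u', u'', hu, hu0, heq⟩ := exists_periodic_of_lipschitz (c := c) (ξ := ξ)
    (K := p * m ^ (-p - 1)) hT ha haT hapos he heT
    hb hbω (antitone_rpow_neg_max hp hm) (by positivity) fun x y =>
      (abs_rpow_neg_sub_le hp hm (le_max_right _ _) (le_max_right _ _)).trans
        (mul_le_mul_of_nonneg_left (abs_max_sub_max_le_abs x y m) (by positivity))
  have hmu := hlow m ξ μ u u' u'' hm le_rfl le_rfl hu hu0 heq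
  simp only [max_eq_left (hmu _)] at heq
  exact ⟨μ, u, .of_jet hu (fun t => hm.trans_le (hmu t)) heq, (periodAverage_eq_iff hT).2 hu0⟩

theorem IsPosPeriodicSol.exists_lower_bound {T p b c x : ℝ} {a e : ℝ → ℝ} (hT : 0 < T) (hp : 0 < p)
    (ha : Continuous a) (haT : Function.Periodic a T) (hapos : ∀ t, 0 < a t)
    (he : Continuous e) (heT : Function.Periodic e T) (hemean : ∫ t in (0 : ℝ)..T, e t = 0)
    (hb : 0 < b) (hbω : b < (2 * Real.pi / T) ^ 2) (hx : 0 < x) :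
    ∃ m, 0 < m ∧ ∀ (μ : ℝ) (u : ℝ → ℝ), IsPosPeriodicSol T p b c a e μ u →
      x ≤ periodAverage T u → ∀ t, m ≤ u t := by
  obtain ⟨m, hm, hlow⟩ := IsPeriodicJet.exists_lower_bound (c := c) hT hp ha haT hapos he heT
    hemean hb hbω hx
  refine ⟨m, hm, fun μ u hu hxu => ?_⟩
  -- A positive solution solves the truncated equation for any `δ` not above its own minimum.
  obtain ⟨s, hs⟩ := hu.periodic.exists_forall_le_of_continuous hT hu.jet.cont
  refine hlow (min m (u s)) _ μ u _ _ (lt_min hm (hu.pos s)) (min_le_left _ _) hxu hu.jet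
    ((periodAverage_eq_iff hT).1 rfl) fun t => ?_
  rw [max_eq_left ((min_le_right _ _).trans (hs t))]
  exact hu.eqn_rpow_neg t

/-! ### Uniqueness and Lipschitz dependence on the average -/

/-- For `w` a difference of solutions with average `d`, test with `w - d`: this removes `Δ`,
monotonicity disposes of `G w`, and only the cross term `d G` remains. The case `d = 0` is
uniqueness. -/
theorem IsPeriodicJet.lipschitz_bound {T b c d Δ K : ℝ} {w w' w'' G : ℝ → ℝ} (hT : 0 < T)
    (hb : 0 < b) (hbω : b < (2 * Real.pi / T) ^ 2) (hw : IsPeriodicJet T w w' w'')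
    (hwd : ∫ t in (0 : ℝ)..T, w t = d * T) (hK : 0 ≤ K)
    (hGK : ∀ t, |G t| ≤ K * |w t|) (hGw : ∀ t, G t * w t ≤ 0)
    (heq : ∀ t, w'' t + c * w' t + b * w t + G t = Δ) :
    (∀ t, |w t| ≤
      (2 + 2 * (T ^ 2 * K * ((2 * Real.pi / T) ^ 2 / ((2 * Real.pi / T) ^ 2 - b)))) * |d|) ∧
    ∫ t in (0 : ℝ)..T, w' t ^ 2 ≤ T * K * ((2 * Real.pi / T) ^ 2 / ((2 * Real.pi / T) ^ 2 - b)) *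
      (2 + 2 * (T ^ 2 * K * ((2 * Real.pi / T) ^ 2 / ((2 * Real.pi / T) ^ 2 - b)))) * d ^ 2 := by
  set q := (2 * Real.pi / T) ^ 2
  set B := T ^ 2 * K * (q / (q - b)) with hB
  have hU := hw.add_const (-d)
  simp only [← sub_eq_add_neg] at hU
  have hwc := hw.cont
  have hwc' := hw.cont'
  have hwc'' := hw.cont''
  have hU0 : ∫ t in (0 : ℝ)..T, (w t - d) = 0 := by
    rw [intervalIntegral.integral_sub (hwc.intervalIntegrable _ _) (by simp), hwd]
    simp [mul_comm]
  have hqb : 0 < q - b := sub_pos.2 hbω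
  have hq : 0 < q := hb.trans hbω
  have hB0 : 0 ≤ B := by positivity
  obtain ⟨t₀, ht₀⟩ := Function.Periodic.exists_forall_ge_of_continuous (f := fun t => |w t - d|) hT
    (fun t => by simp only [hw.periodic t]) (by fun_prop)
  set s := |w t₀ - d| with hs
  have hs0 : 0 ≤ s := abs_nonneg _
  have hwir := hU.wirtinger hT hU0
  have hsup := hU.sq_le hT hU0 t₀
  rw [← sq_abs, ← hs] at hsup
  have hws : ∀ t, |w t| ≤ |d| + s := fun t => by
    calc |w t| = |(w t - d) + d| := by rw [sub_add_cancel]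
      _ ≤ |w t - d| + |d| := abs_add_le _ _
      _ ≤ _ := by linarith [ht₀ t]
  have hen : ∫ t in (0 : ℝ)..T, (w t - d) * (w'' t + c * w' t) ≥
      ∫ t in (0 : ℝ)..T, ((Δ - b * d) * (w t - d) - b * (w t - d) ^ 2 -
        |d| * (K * (|d| + s))) := by
    refine integral_mono_on hT.le (Continuous.intervalIntegrable (by fun_prop) _ _)
      (Continuous.intervalIntegrable (by fun_prop) _ _) fun t _ => ?_
    have e1 : (w t - d) * (w'' t + c * w' t)
        = (Δ - b * d) * (w t - d) - b * (w t - d) ^ 2 - G t * w t + d * G t := by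
      linear_combination (w t - d) * heq t
    have h1 : |d * G t| ≤ |d| * (K * (|d| + s)) := by
      rw [abs_mul]
      have := hws t
      gcongr
      exact (hGK t).trans (by gcongr)
    linarith [(abs_le.1 h1).1, hGw t]
  rw [hU.integral_mul_second_order, intervalIntegral.integral_sub,
    intervalIntegral.integral_sub] at hen
  rotate_left
  any_goals exact Continuous.intervalIntegrable (by fun_prop) _ _
  simp only [intervalIntegral.integral_const_mul (Δ - b * d), intervalIntegral.integral_const_mul b,
    intervalIntegral.integral_const, hU0, smul_eq_mul] at hen
  set ID := ∫ t in (0 : ℝ)..T, w' t ^ 2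
  set I2 := ∫ t in (0 : ℝ)..T, (w t - d) ^ 2
  have hID : ID ≤ T * K * (q / (q - b)) * (|d| * (|d| + s)) := by
    have h1 : (q - b) * ID ≤ q * (T * (|d| * (K * (|d| + s)))) := by
      have h3 := mul_le_mul_of_nonneg_left hwir hb.le
      have h4 := mul_le_mul_of_nonneg_left hen hq.le
      linarith
    have h5 : ID ≤ q * (T * (|d| * (K * (|d| + s)))) / (q - b) := by
      rw [le_div_iff₀ hqb]; linarith
    exact h5.trans (le_of_eq (by ring))
  have hs2 : s ^ 2 ≤ B * (|d| * (|d| + s)) := by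
    refine hsup.trans ((mul_le_mul_of_nonneg_left hID hT.le).trans (le_of_eq ?_))
    rw [hB]; ring
  have hd0 := abs_nonneg d
  -- If `s` exceeded this, then `|d| ≤ s`, and the quadratic inequality would give `s ≤ 2 B |d|`.
  have hsB : s ≤ (1 + 2 * B) * |d| := by
    by_contra! hlt
    have hds : |d| ≤ s := by nlinarith
    have hs1 : 0 < s := lt_of_le_of_lt (by positivity) hlt
    have h1 : s * s ≤ (2 * B * |d|) * s := by
      calc s * s = s ^ 2 := by ring
        _ ≤ B * (|d| * (|d| + s)) := hs2
        _ ≤ B * (|d| * (s + s)) := by gcongr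
        _ = _ := by ring
    have := le_of_mul_le_mul_right h1 hs1
    linarith
  refine ⟨fun t => (hws t).trans (by linarith), hID.trans ?_⟩
  have h1 : |d| * (|d| + s) ≤ |d| * ((2 + 2 * B) * |d|) := by
    gcongr
    linarith
  calc _ ≤ T * K * (q / (q - b)) * (|d| * ((2 + 2 * B) * |d|)) := by gcongr
    _ = T * K * (q / (q - b)) * (2 + 2 * B) * |d| ^ 2 := by ring
    _ = _ := by rw [sq_abs]

theorem sq_sub_sub_sub_le (x y z w : ℝ) :
    (x - y - z - w) ^ 2 ≤ 4 * (x ^ 2 + y ^ 2 + z ^ 2 + w ^ 2) := by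
  linarith [sq_nonneg (x + y), sq_nonneg (x + z), sq_nonneg (x + w), sq_nonneg (y - z),
    sq_nonneg (y - w), sq_nonneg (z - w)]

theorem IsPosPeriodicSol.exists_lipschitz_bound {T p b c x : ℝ} {a e : ℝ → ℝ} (hT : 0 < T)
    (hp : 0 < p) (ha : Continuous a) (haT : Function.Periodic a T) (hapos : ∀ t, 0 < a t)
    (he : Continuous e) (heT : Function.Periodic e T) (hemean : ∫ t in (0 : ℝ)..T, e t = 0)
    (hb : 0 < b) (hbω : b < (2 * Real.pi / T) ^ 2) (hx : 0 < x) :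
    ∃ C, 0 ≤ C ∧ ∀ (μ ν : ℝ) (u v : ℝ → ℝ), IsPosPeriodicSol T p b c a e μ u →
      IsPosPeriodicSol T p b c a e ν v → x ≤ periodAverage T u → x ≤ periodAverage T v →
      (∀ t, |u t - v t| ≤ C * |periodAverage T u - periodAverage T v|) ∧
      |μ - ν| ≤ C * |periodAverage T u - periodAverage T v| ∧
      sqDistH2 T u v ≤ C * (periodAverage T u - periodAverage T v) ^ 2 := by
  obtain ⟨m, hm, hlow⟩ := IsPosPeriodicSol.exists_lower_bound (c := c) hT hp ha haT hapos he heT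
    hemean hb hbω hx
  obtain ⟨A, hA0, hA⟩ := haT.exists_abs_le_of_continuous hT ha
  set K := A * (p * m ^ (-p - 1)) with hKdef
  have hK : 0 ≤ K := by positivity
  have hqb : 0 < (2 * Real.pi / T) ^ 2 - b := sub_pos.2 hbω
  set L := 2 + 2 * (T ^ 2 * K * ((2 * Real.pi / T) ^ 2 / ((2 * Real.pi / T) ^ 2 - b))) with hL
  have hL0 : 0 ≤ L := by positivity
  set D := T * K * ((2 * Real.pi / T) ^ 2 / ((2 * Real.pi / T) ^ 2 - b)) * L with hD
  have hD0 : 0 ≤ D := by positivity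
  -- `N` bounds the change of `μ`, from the averaged equation; `Q` bounds the `H²` distance, with
  -- the second derivative expressed through the equation.
  set N := b + K * L with hN
  have hN0 : 0 ≤ N := by positivity
  set Q := T * (L ^ 2 + 4 * (N ^ 2 + b ^ 2 * L ^ 2 + K ^ 2 * L ^ 2)) + (1 + 4 * c ^ 2) * D with hQ
  have hQ0 : 0 ≤ Q := by positivity
  clear_value L D N Q
  refine ⟨L + N + Q, by positivity, fun μ ν u v hu hv hxu hxv => ?_⟩
  set d := periodAverage T u - periodAverage T v with hd
  have hdn := abs_nonneg d
  have hw := hu.jet.sub hv.jet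
  have huc := hu.jet.cont
  have hvc := hv.jet.cont
  have hwc := hw.cont
  have hwc' := hw.cont'
  have hwc'' := hw.cont''
  set G : ℝ → ℝ := fun t => a t * (u t ^ (-p) - v t ^ (-p)) with hG
  have hGc : Continuous G := ha.mul ((huc.rpow_const fun t => Or.inl (hu.pos t).ne').sub
    (hvc.rpow_const fun t => Or.inl (hv.pos t).ne'))
  have hGK : ∀ t, |G t| ≤ K * |u t - v t| := by
    intro t
    rw [hG, abs_mul, hKdef, mul_assoc]
    have := abs_rpow_neg_sub_le hp hm (hlow μ u hu hxu t) (hlow ν v hv hxv t)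
    gcongr
    exact hA t
  have hGw : ∀ t, G t * (u t - v t) ≤ 0 := by
    intro t
    rcases le_total (u t) (v t) with h | h
    · have h1 := Real.rpow_le_rpow_of_nonpos (hu.pos t) h (by linarith : -p ≤ 0)
      exact mul_nonpos_of_nonneg_of_nonpos (mul_nonneg (hapos t).le (sub_nonneg.2 h1))
        (sub_nonpos.2 h)
    · have h1 := Real.rpow_le_rpow_of_nonpos (hv.pos t) h (by linarith : -p ≤ 0)
      exact mul_nonpos_of_nonpos_of_nonneg
        (mul_nonpos_of_nonneg_of_nonpos (hapos t).le (sub_nonpos.2 h1)) (sub_nonneg.2 h)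
  have heq : ∀ t, (deriv (deriv u) t - deriv (deriv v) t) + c * (deriv u t - deriv v t)
      + b * (u t - v t) + G t = μ - ν := fun t => by
    simp only [hG]
    linear_combination hu.eqn_rpow_neg t - hv.eqn_rpow_neg t
  have hwd : ∫ t in (0 : ℝ)..T, (u t - v t) = d * T := by
    rw [intervalIntegral.integral_sub (huc.intervalIntegrable _ _) (hvc.intervalIntegrable _ _),
      (periodAverage_eq_iff hT).1 rfl, (periodAverage_eq_iff (u := v) hT).1 rfl, hd]
    ring
  obtain ⟨h1, h2⟩ := hw.lipschitz_bound hT hb hbω hwd hK hGK hGw heq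
  rw [← hL] at h1 h2
  rw [← hD] at h2
  have hGL : ∀ t, |G t| ≤ K * L * |d| := fun t =>
    (hGK t).trans ((mul_le_mul_of_nonneg_left (h1 t) hK).trans (le_of_eq (by ring)))
  have hμ : |μ - ν| ≤ N * |d| := by
    have e1 : ∫ t in (0 : ℝ)..T, ((deriv (deriv u) t - deriv (deriv v) t)
        + c * (deriv u t - deriv v t) + b * (u t - v t) + G t)
        = ∫ t in (0 : ℝ)..T, (μ - ν) := by simp only [heq]
    rw [intervalIntegral.integral_add, intervalIntegral.integral_add,
      intervalIntegral.integral_add] at e1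
    rotate_left
    any_goals exact Continuous.intervalIntegrable (by fun_prop) _ _
    rw [intervalIntegral.integral_const_mul c, intervalIntegral.integral_const_mul b,
      hw.integral_deriv, hw.integral_deriv', hwd, intervalIntegral.integral_const] at e1
    simp only [smul_eq_mul, sub_zero] at e1
    have h3 : |(∫ t in (0 : ℝ)..T, G t)| ≤ T * (K * L * |d|) := by
      have := norm_integral_le_of_norm_le_const (a := 0) (b := T) (f := G)
        (fun t _ => (Real.norm_eq_abs (G t)).trans_le (hGL t))
      rw [Real.norm_eq_abs, sub_zero, abs_of_pos hT] at this
      linarith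
    have h4 : T * |μ - ν| ≤ T * (N * |d|) := by
      calc T * |μ - ν| = |T * (μ - ν)| := by rw [abs_mul, abs_of_pos hT]
        _ = |b * (d * T) + ∫ t in (0 : ℝ)..T, G t| := by rw [← e1]; ring_nf
        _ ≤ |b * (d * T)| + |(∫ t in (0 : ℝ)..T, G t)| := abs_add_le _ _
        _ ≤ b * (|d| * T) + T * (K * L * |d|) := by
          rw [abs_mul, abs_mul, abs_of_pos hT, abs_of_pos hb]
          gcongr
        _ = _ := by rw [hN]; ring
    exact le_of_mul_le_mul_left h4 hT
  have hsq : ∀ y k : ℝ, 0 ≤ k → |y| ≤ k * |d| → y ^ 2 ≤ k ^ 2 * d ^ 2 := by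
    intro y k hk hy
    calc y ^ 2 = |y| ^ 2 := (sq_abs y).symm
      _ ≤ (k * |d|) ^ 2 := by gcongr
      _ = _ := by rw [mul_pow, sq_abs]
  have hdist : sqDistH2 T u v ≤ Q * d ^ 2 := by
    have h3 : sqDistH2 T u v ≤ ∫ t in (0 : ℝ)..T,
        ((L ^ 2 + 4 * (N ^ 2 + b ^ 2 * L ^ 2 + K ^ 2 * L ^ 2)) * d ^ 2
          + (1 + 4 * c ^ 2) * (deriv u t - deriv v t) ^ 2) := by
      refine integral_mono_on hT.le (Continuous.intervalIntegrable (by fun_prop) _ _)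
        (Continuous.intervalIntegrable (by fun_prop) _ _) fun t _ => ?_
      have e1 : deriv (deriv u) t - deriv (deriv v) t = (μ - ν) - c * (deriv u t - deriv v t)
        - b * (u t - v t) - G t := by linarith [heq t]
      rw [e1]
      have i1 := hsq _ _ hL0 (h1 t)
      have i2 := hsq _ _ hN0 hμ
      have i3 := hsq _ _ (mul_nonneg hK hL0) (hGL t)
      have i4 := mul_le_mul_of_nonneg_left i1 (sq_nonneg b)
      generalize u t - v t = w at *
      generalize deriv u t - deriv v t = w' at *
      generalize G t = g at *
      generalize μ - ν = δ at *
      have i5 := sq_sub_sub_sub_le δ (c * w') (b * w) g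
      rw [mul_pow, mul_pow] at i5
      linarith
    refine h3.trans ?_
    rw [intervalIntegral.integral_add (Continuous.intervalIntegrable (by fun_prop) _ _)
      (Continuous.intervalIntegrable (by fun_prop) _ _), intervalIntegral.integral_const,
      intervalIntegral.integral_const_mul, smul_eq_mul, sub_zero]
    have := mul_le_mul_of_nonneg_left h2 (by positivity : 0 ≤ 1 + 4 * c ^ 2)
    rw [hQ]
    linarith
  have hd2 := sq_nonneg d
  refine ⟨fun t => (h1 t).trans ?_, hμ.trans ?_, hdist.trans ?_⟩
  all_goals gcongr; linarith

theorem IsPosPeriodicSol.unique_of_periodAverage_eq {T p b c μ ν : ℝ} {a e u v : ℝ → ℝ}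
    (hT : 0 < T)
    (hp : 0 < p) (ha : Continuous a) (haT : Function.Periodic a T) (hapos : ∀ t, 0 < a t)
    (he : Continuous e) (heT : Function.Periodic e T) (hemean : ∫ t in (0 : ℝ)..T, e t = 0)
    (hb : 0 < b) (hbω : b < (2 * Real.pi / T) ^ 2) (hu : IsPosPeriodicSol T p b c a e μ u)
    (hv : IsPosPeriodicSol T p b c a e ν v) (h : periodAverage T u = periodAverage T v) :
    μ = ν ∧ u = v := by
  obtain ⟨C, -, hC⟩ := IsPosPeriodicSol.exists_lipschitz_bound (c := c) hT hp ha haT hapos he heT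
    hemean hb hbω (hu.periodAverage_pos hT)
  obtain ⟨h1, h2, -⟩ := hC μ ν u v hu hv le_rfl h.le
  rw [h, sub_self, abs_zero, mul_zero] at h1 h2
  exact ⟨sub_eq_zero.1 (abs_nonpos_iff.1 h2),
    funext fun t => sub_eq_zero.1 (abs_nonpos_iff.1 (h1 t))⟩

/-! ### Ordering of solutions and the exact multiplicity bound -/

theorem exists_first_zero {f : ℝ → ℝ} {s r : ℝ} (hf : Continuous f) (hs : 0 < f s) (hr : f r ≤ 0)
    (hsr : s < r) : ∃ β ∈ Ioc s r, f β = 0 ∧ ∀ t ∈ Ico s β, 0 < f t := by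
  have hcomp : IsCompact (Icc s r ∩ f ⁻¹' Iic 0) := isCompact_Icc.inter_right (isClosed_Iic.preimage hf)
  obtain ⟨β, ⟨hβ, hβ0⟩, hleast⟩ := hcomp.exists_isLeast ⟨r, ⟨hsr.le, le_rfl⟩, hr⟩
  have hpos : ∀ t ∈ Ico s β, 0 < f t := fun t ht => by
    by_contra! hle
    exact absurd (hleast ⟨⟨ht.1, ht.2.le.trans hβ.2⟩, hle⟩) (not_le.2 ht.2)
  obtain ⟨z, hz, hz0⟩ := intermediate_value_Icc' hβ.1 hf.continuousOn
    (show (0 : ℝ) ∈ Icc (f β) (f s) from ⟨hβ0, hs.le⟩)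
  have hzβ : z = β := le_antisymm hz.2 (hleast ⟨⟨hz.1, hz.2.trans hβ.2⟩, hz0.le⟩)
  rw [hzβ] at hz0
  refine ⟨β, ⟨lt_of_le_of_ne hβ.1 fun h => ?_, hβ.2⟩, hz0, hpos⟩
  rw [h] at hs
  exact hs.ne' hz0

theorem exists_last_zero {f : ℝ → ℝ} {s r : ℝ} (hf : Continuous f) (hs : 0 < f s) (hr : f r ≤ 0)
    (hrs : r < s) : ∃ α ∈ Ico r s, f α = 0 ∧ ∀ t ∈ Ioc α s, 0 < f t := by
  obtain ⟨β, hβ, hβ0, hpos⟩ := exists_first_zero (f := fun t => f (-t)) (s := -s) (r := -r)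
    (by fun_prop) (by simpa using hs) (by simpa using hr) (neg_lt_neg hrs)
  refine ⟨-β, ⟨by linarith [hβ.2], by linarith [hβ.1]⟩, hβ0, fun t ht => ?_⟩
  simpa using hpos (-t) ⟨by linarith [ht.2], by linarith [ht.1]⟩

/-- Sturm comparison with `sin (ω (t - α))`, whose half-wave has length `T / 2`. The substitution `y
= exp (c t / 2) w` removes the damping and turns `b` into `b - c² / 4`, still below `ω²`. -/
theorem half_period_lt_of_consecutive_zeros {T b c α β : ℝ} {w w' w'' G : ℝ → ℝ} (hT : 0 < T)
    (hbω : b < (2 * Real.pi / T) ^ 2) (hw : ∀ t, HasDerivAt w (w' t) t)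
    (hw' : ∀ t, HasDerivAt w' (w'' t) t)
    (heq : ∀ t, w'' t + c * w' t + b * w t + G t = 0) (hαβ : α < β) (hα : w α = 0) (hβ : w β = 0)
    (hpos : ∀ t ∈ Ioo α β, 0 < w t) (hG : ∀ t ∈ Ioo α β, G t ≤ 0) : T / 2 < β - α := by
  by_contra! hle
  set ω := 2 * Real.pi / T with hω
  have hpi := Real.pi_pos
  have hω0 : 0 < ω := by positivity
  have hωT : ω * (T / 2) = Real.pi := by rw [hω]; field_simp
  have hs0 : ∀ t ∈ Icc α β, 0 ≤ Real.sin (ω * (t - α)) := fun t ht =>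
    Real.sin_nonneg_of_nonneg_of_le_pi (mul_nonneg hω0.le (sub_nonneg.2 ht.1)) (by
      rw [← hωT]; gcongr; linarith [ht.2])
  have hs1 : ∀ t ∈ Ioo α β, 0 < Real.sin (ω * (t - α)) := fun t ht =>
    Real.sin_pos_of_pos_of_lt_pi (mul_pos hω0 (sub_pos.2 ht.1)) (by
      rw [← hωT]; gcongr; linarith [ht.2])
  -- The Wronskian of `y` and the sine: strictly increasing on `[α, β]`, yet zero at `α` and
  -- nonpositive at `β`.
  set Z : ℝ → ℝ := fun t => Real.exp (c / 2 * t) *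
    ((w' t + c / 2 * w t) * Real.sin (ω * (t - α)) - w t * (ω * Real.cos (ω * (t - α)))) with hZ
  have hlin : ∀ t, HasDerivAt (fun t => ω * (t - α)) ω t := fun t => by
    simpa using ((hasDerivAt_id t).sub_const α).const_mul ω
  have hZd : ∀ t, HasDerivAt Z (Real.exp (c / 2 * t) * (Real.sin (ω * (t - α)) *
      ((ω ^ 2 - b + (c / 2) ^ 2) * w t - G t))) t := by
    intro t
    have hexp : HasDerivAt (fun t => Real.exp (c / 2 * t)) (Real.exp (c / 2 * t) * (c / 2)) t := by
      simpa using ((hasDerivAt_id t).const_mul (c / 2)).exp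
    refine (hexp.mul ((((hw' t).add ((hw t).const_mul (c / 2))).mul (hlin t).sin).sub
      ((hw t).mul ((hlin t).cos.const_mul ω)))).congr_deriv ?_
    have h1 : w'' t = - c * w' t - b * w t - G t := by linarith [heq t]
    simp only [Pi.add_apply, Pi.sub_apply, Pi.mul_apply, h1]
    ring
  have hmono : StrictMonoOn Z (Icc α β) := by
    refine strictMonoOn_of_deriv_pos (convex_Icc α β)
      (fun t _ => (hZd t).continuousAt.continuousWithinAt) fun t ht => ?_
    rw [interior_Icc] at ht
    rw [(hZd t).deriv]
    have h1 : 0 < (ω ^ 2 - b + (c / 2) ^ 2) * w t :=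
      mul_pos (add_pos_of_pos_of_nonneg (sub_pos.2 hbω) (sq_nonneg _)) (hpos t ht)
    exact mul_pos (Real.exp_pos _) (mul_pos (hs1 t ht) (by linarith [hG t ht]))
  have hlt := hmono (left_mem_Icc.2 hαβ.le) (right_mem_Icc.2 hαβ.le) hαβ
  have hβ' : w' β ≤ 0 := by
    have htend : Tendsto (slope w β) (𝓝[<] β) (𝓝 (w' β)) :=
      (hasDerivAt_iff_tendsto_slope.1 (hw β)).mono_left
        (nhdsWithin_mono _ fun t (ht : t < β) => ht.ne)
    refine le_of_tendsto htend ?_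
    filter_upwards [Ioo_mem_nhdsLT hαβ] with t ht
    rw [slope_def_field, hβ, sub_zero]
    exact div_nonpos_of_nonneg_of_nonpos (hpos t ht).le (sub_nonpos.2 ht.2.le)
  have h1 : Z α = 0 := by simp [hZ, hα]
  have h2 : Z β ≤ 0 := by
    simp only [hZ, hβ, mul_zero, add_zero, zero_mul, sub_zero]
    exact mul_nonpos_of_nonneg_of_nonpos (Real.exp_pos _).le
      (mul_nonpos_of_nonpos_of_nonneg hβ' (hs0 β (right_mem_Icc.2 hαβ.le)))
  linarith

/-- Grönwall for the energy `w² + w'²`, with one exponential weight for each direction of time. -/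
theorem eq_zero_of_double_zero {b c K t₀ : ℝ} {w w' w'' G : ℝ → ℝ} (hb : 0 < b) (hK : 0 ≤ K)
    (hw : ∀ t, HasDerivAt w (w' t) t) (hw' : ∀ t, HasDerivAt w' (w'' t) t)
    (heq : ∀ t, w'' t + c * w' t + b * w t + G t = 0) (hG : ∀ t, |G t| ≤ K * |w t|)
    (h0 : w t₀ = 0) (h0' : w' t₀ = 0) (t : ℝ) : w t = 0 := by
  set E : ℝ → ℝ := fun t => w t ^ 2 + w' t ^ 2 with hE
  set C := 1 + b + K + 2 * |c| with hC
  have hEd : ∀ t, HasDerivAt E (2 * w t * w' t + 2 * w' t * w'' t) t := fun t =>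
    (((hw t).pow 2).add ((hw' t).pow 2)).congr_deriv (by simp)
  have hbd : ∀ t, |2 * w t * w' t + 2 * w' t * w'' t| ≤ C * E t := by
    intro t
    have e : 2 * w t * w' t + 2 * w' t * w'' t
        = 2 * (1 - b) * (w t * w' t) - 2 * (w' t * G t) - 2 * c * w' t ^ 2 := by
      have h1 : w'' t = - c * w' t - b * w t - G t := by linarith [heq t]
      rw [h1]; ring
    have h1 : 2 * (|w t| * |w' t|) ≤ E t := by
      have := sq_nonneg (|w t| - |w' t|)
      rw [sub_sq, sq_abs, sq_abs] at this
      simp only [hE]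
      linarith
    have hwE : w' t ^ 2 ≤ E t := by simp only [hE]; linarith [sq_nonneg (w t)]
    have i1 : |2 * (1 - b) * (w t * w' t)| ≤ (1 + b) * E t := by
      rw [abs_mul, abs_mul, abs_mul, abs_two]
      have : |1 - b| ≤ 1 + b := by rw [abs_le]; constructor <;> linarith
      calc 2 * |1 - b| * (|w t| * |w' t|) = |1 - b| * (2 * (|w t| * |w' t|)) := by ring
        _ ≤ _ := by gcongr
    have i2 : |2 * (w' t * G t)| ≤ K * E t := by
      rw [abs_mul, abs_mul, abs_two]
      calc 2 * (|w' t| * |G t|) ≤ 2 * (|w' t| * (K * |w t|)) := by gcongr; exact hG t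
        _ = K * (2 * (|w t| * |w' t|)) := by ring
        _ ≤ _ := by gcongr
    have i3 : |2 * c * w' t ^ 2| ≤ 2 * |c| * E t := by
      rw [abs_mul, abs_mul, abs_two, abs_of_nonneg (sq_nonneg (w' t))]
      gcongr
    rw [e]
    refine (abs_sub _ _).trans ((add_le_add_left (abs_sub _ _) _).trans ?_)
    rw [hC]
    linarith
  have hexp : ∀ k t : ℝ, HasDerivAt (fun t => Real.exp (k * t)) (Real.exp (k * t) * k) t :=
    fun k t => by simpa using ((hasDerivAt_id t).const_mul k).exp
  have hanti : Antitone fun t => Real.exp (-C * t) * E t := by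
    refine antitone_of_hasDerivAt_nonpos (fun t => (hexp (-C) t).mul (hEd t)) fun t => ?_
    have := mul_nonneg (Real.exp_pos (-C * t)).le (sub_nonneg.2 (abs_le.1 (hbd t)).2)
    simp only [Pi.zero_apply]
    linarith
  have hmon : Monotone fun t => Real.exp (C * t) * E t := by
    refine monotone_of_hasDerivAt_nonneg (fun t => (hexp C t).mul (hEd t)) fun t => ?_
    have := mul_nonneg (Real.exp_pos (C * t)).le (neg_le_iff_add_nonneg'.1 (abs_le.1 (hbd t)).1)
    simp only [Pi.zero_apply]
    linarith
  have hE0 : E t₀ = 0 := by simp [hE, h0, h0']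
  have hEt : E t ≤ 0 := by
    rcases le_total t t₀ with h | h
    · have := hmon h
      simp only [hE0, mul_zero] at this
      exact nonpos_of_mul_nonpos_right this (Real.exp_pos _)
    · have := hanti h
      simp only [hE0, mul_zero] at this
      exact nonpos_of_mul_nonpos_right this (Real.exp_pos _)
  have : w t ^ 2 ≤ 0 := by
    simp only [hE] at hEt
    linarith [sq_nonneg (w' t)]
  exact pow_eq_zero_iff two_ne_zero |>.1 (le_antisymm this (sq_nonneg _))

theorem IsPeriodicJet.no_sign_change {T b c : ℝ} {w w' w'' G : ℝ → ℝ} (hT : 0 < T)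
    (hbω : b < (2 * Real.pi / T) ^ 2) (hw : IsPeriodicJet T w w' w'')
    (heq : ∀ t, w'' t + c * w' t + b * w t + G t = 0)
    (hGn : ∀ t, 0 < w t → G t ≤ 0) (hGp : ∀ t, w t < 0 → 0 ≤ G t) :
    (∀ t, 0 ≤ w t) ∨ (∀ t, w t ≤ 0) := by
  by_contra! hcon
  obtain ⟨⟨r', hr'⟩, s, hs⟩ := hcon
  have hwc := hw.cont
  obtain ⟨r, hr, hrr⟩ := hw.periodic.exists_mem_Ico hT r' s
  rw [hrr] at hr'
  have hsr : s < r := lt_of_le_of_ne hr.1 fun h => by rw [← h] at hr'; linarith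
  have hrT : w (r - T) < 0 := by rwa [hw.periodic.sub_eq]
  -- A positive nodal interval around `s` and a negative one around `r` fit side by side into `[α, α
  -- + T]`, although each is longer than `T / 2`.
  obtain ⟨β, hβ, hβ0, hβp⟩ := exists_first_zero hwc hs hr'.le hsr
  obtain ⟨α, hα, hα0, hαp⟩ := exists_last_zero hwc hs hrT.le (by linarith [hr.2])
  have hβr : β < r := lt_of_le_of_ne hβ.2 fun h => by rw [h] at hβ0; linarith
  have hαr : r - T < α := lt_of_le_of_ne hα.1 fun h => by rw [h] at hrT; linarith
  have hαT : w (α + T) = 0 := by rw [hw.periodic, hα0]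
  obtain ⟨α', hα', hα0', hαp'⟩ := exists_last_zero (f := fun t => - w t) hwc.neg (neg_pos.2 hr')
    (by simp [hβ0]) hβr
  obtain ⟨β', hβ', hβ0', hβp'⟩ := exists_first_zero (f := fun t => - w t) (r := α + T) hwc.neg
    (neg_pos.2 hr') (by simp [hαT]) (by linarith)
  have hp : ∀ t ∈ Ioo α β, 0 < w t := fun t ht => by
    rcases le_total t s with h | h
    · exact hαp t ⟨ht.1, h⟩
    · exact hβp t ⟨h, ht.2⟩
  have hn : ∀ t ∈ Ioo α' β', 0 < - w t := fun t ht => by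
    rcases le_total t r with h | h
    · exact hαp' t ⟨ht.1, h⟩
    · exact hβp' t ⟨h, ht.2⟩
  have h1 := half_period_lt_of_consecutive_zeros hT hbω hw.hasDerivAt hw.hasDerivAt' heq
    (hα.2.trans hβ.1) hα0 hβ0 hp fun t ht => hGn t (hp t ht)
  have h2 := half_period_lt_of_consecutive_zeros (c := c) (w := fun t => - w t)
    (G := fun t => - G t) hT hbω
    (fun t => (hw.hasDerivAt t).neg) (fun t => (hw.hasDerivAt' t).neg)
    (fun t => by linarith [heq t]) (hα'.2.trans hβ'.1) hα0' hβ0' hn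
    fun t ht => neg_nonpos.2 (hGp t (neg_pos.1 (hn t ht)))
  linarith [hα'.1, hβ'.2]

theorem IsPosPeriodicSol.lt_or_gt {T p b c μ : ℝ} {a e u v : ℝ → ℝ} (hT : 0 < T) (hp : 0 < p)
    (ha : Continuous a) (haT : Function.Periodic a T) (hapos : ∀ t, 0 < a t)
    (hb : 0 < b) (hbω : b < (2 * Real.pi / T) ^ 2) (hu : IsPosPeriodicSol T p b c a e μ u)
    (hv : IsPosPeriodicSol T p b c a e μ v) (hne : u ≠ v) :
    (∀ t, u t < v t) ∨ (∀ t, v t < u t) := by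
  have hw := hu.jet.sub hv.jet
  obtain ⟨A, hA0, hA⟩ := haT.exists_abs_le_of_continuous hT ha
  obtain ⟨su, hsu⟩ := hu.periodic.exists_forall_le_of_continuous hT hu.jet.cont
  obtain ⟨sv, hsv⟩ := hv.periodic.exists_forall_le_of_continuous hT hv.jet.cont
  set m := min (u su) (v sv)
  have hm : 0 < m := lt_min (hu.pos _) (hv.pos _)
  set G : ℝ → ℝ := fun t => a t * (u t ^ (-p) - v t ^ (-p)) with hG
  have hGK : ∀ t, |G t| ≤ A * (p * m ^ (-p - 1)) * |u t - v t| := by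
    intro t
    rw [hG, abs_mul, mul_assoc]
    have := abs_rpow_neg_sub_le hp hm ((min_le_left _ _).trans (hsu t))
      ((min_le_right _ _).trans (hsv t))
    gcongr
    exact hA t
  have heq : ∀ t, (deriv (deriv u) t - deriv (deriv v) t) + c * (deriv u t - deriv v t)
      + b * (u t - v t) + G t = 0 := fun t => by
    simp only [hG]
    linear_combination hu.eqn_rpow_neg t - hv.eqn_rpow_neg t
  -- Once signs are fixed, a contact point of `u` and `v` is an extremum of the difference, hence a
  -- double zero.
  have hzero : ∀ t, u t - v t = 0 → deriv u t - deriv v t = 0 → False := fun t h1 h2 =>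
    hne (funext fun r => sub_eq_zero.1 (eq_zero_of_double_zero hb (by positivity) hw.hasDerivAt
      hw.hasDerivAt' heq hGK h1 h2 r))
  rcases hw.no_sign_change hT hbω heq
    (fun t ht => mul_nonpos_of_nonneg_of_nonpos (hapos t).le (sub_nonpos.2
      (Real.rpow_le_rpow_of_nonpos (hv.pos t) (sub_pos.1 ht).le (by linarith))))
    (fun t ht => mul_nonneg (hapos t).le (sub_nonneg.2
      (Real.rpow_le_rpow_of_nonpos (hu.pos t) (sub_neg.1 ht).le (by linarith)))) with h | h
  · refine Or.inr fun t => lt_of_le_of_ne (sub_nonneg.1 (h t)) fun h0 => ?_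
    have hz : u t - v t = 0 := by rw [h0, sub_self]
    have hmin : IsLocalMin (fun t => u t - v t) t := Eventually.of_forall fun r => by
      simpa only [hz] using h r
    exact hzero t hz (hmin.hasDerivAt_eq_zero (hw.hasDerivAt t))
  · refine Or.inl fun t => lt_of_le_of_ne (sub_nonpos.1 (h t)) fun h0 => ?_
    have hz : u t - v t = 0 := by rw [h0, sub_self]
    have hmax : IsLocalMax (fun t => u t - v t) t := Eventually.of_forall fun r => by
      simpa only [hz] using h r
    exact hzero t hz (hmax.hasDerivAt_eq_zero (hw.hasDerivAt t))

theorem rpow_neg_slope_lt {p x y z : ℝ} (hp : 0 < p) (hx : 0 < x) (hxy : x < y) (hyz : y < z) :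
    (y ^ (-p) - x ^ (-p)) * (z - y) < (z ^ (-p) - y ^ (-p)) * (y - x) := by
  have hconv : StrictConvexOn ℝ (Ioi 0) fun t : ℝ => t ^ (-p) := by
    refine StrictMonoOn.strictConvexOn_of_deriv (convex_Ioi 0)
      (fun t ht => (Real.continuousAt_rpow_const t (-p) (Or.inl (ne_of_gt ht))).continuousWithinAt) ?_
    rw [interior_Ioi]
    intro s hs t ht hst
    rw [Real.deriv_rpow_const, Real.deriv_rpow_const]
    have := Real.rpow_lt_rpow_of_neg hs hst (by linarith : -p - 1 < 0)
    nlinarith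
  have := hconv.slope_strict_mono_adjacent hx (hx.trans (hxy.trans hyz)) hxy hyz
  rwa [div_lt_div_iff₀ (sub_pos.2 hxy) (sub_pos.2 hyz)] at this

/-- With `w = v - u` and `y = z - v`, strict convexity makes the weighted Wronskian `exp (c t) (w' y
- w y')` strictly increasing. It vanishes where the periodic quotient `w / y` is maximal, so the
quotient would increase strictly from its maximum on. -/
theorem IsPosPeriodicSol.not_lt_lt {T p b c μ : ℝ} {a e u v z : ℝ → ℝ} (hT : 0 < T) (hp : 0 < p)
    (hapos : ∀ t, 0 < a t) (hu : IsPosPeriodicSol T p b c a e μ u)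
    (hv : IsPosPeriodicSol T p b c a e μ v) (hz : IsPosPeriodicSol T p b c a e μ z)
    (huv : ∀ t, u t < v t) (hvz : ∀ t, v t < z t) : False := by
  have hw := hv.jet.sub hu.jet
  have hy := hz.jet.sub hv.jet
  have hy0 : ∀ t, 0 < z t - v t := fun t => sub_pos.2 (hvz t)
  set Y : ℝ → ℝ := fun t => Real.exp (c * t) *
    ((deriv v t - deriv u t) * (z t - v t) - (v t - u t) * (deriv z t - deriv v t)) with hY
  have hYd : ∀ t, HasDerivAt Y (Real.exp (c * t) * (a t * ((z t ^ (-p) - v t ^ (-p)) * (v t - u t)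
      - (v t ^ (-p) - u t ^ (-p)) * (z t - v t)))) t := by
    intro t
    have hexp : HasDerivAt (fun t => Real.exp (c * t)) (Real.exp (c * t) * c) t := by
      simpa using ((hasDerivAt_id t).const_mul c).exp
    refine (hexp.mul (((hw.hasDerivAt' t).mul (hy.hasDerivAt t)).sub
      ((hw.hasDerivAt t).mul (hy.hasDerivAt' t)))).congr_deriv ?_
    have h1 := hu.eqn_rpow_neg t
    have h2 := hv.eqn_rpow_neg t
    have h3 := hz.eqn_rpow_neg t
    simp only [Pi.sub_apply, Pi.mul_apply]
    linear_combination Real.exp (c * t) * ((h2 - h1) * (z t - v t) - (h3 - h2) * (v t - u t))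
  have hYm : StrictMono Y := strictMono_of_hasDerivAt_pos hYd fun t =>
    mul_pos (Real.exp_pos _) (mul_pos (hapos t)
      (sub_pos.2 (rpow_neg_slope_lt hp (hu.pos t) (huv t) (hvz t))))
  set Q : ℝ → ℝ := fun t => (v t - u t) / (z t - v t) with hQ
  have hQd : ∀ t, HasDerivAt Q (((deriv v t - deriv u t) * (z t - v t)
      - (v t - u t) * (deriv z t - deriv v t)) / (z t - v t) ^ 2) t := fun t =>
    (hw.hasDerivAt t).div (hy.hasDerivAt t) (hy0 t).ne'
  obtain ⟨s, hs⟩ := Function.Periodic.exists_forall_ge_of_continuous (f := Q) hT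
    (fun t => by simp only [hQ, hu.periodic t, hv.periodic t, hz.periodic t])
    (continuous_iff_continuousAt.2 fun t => (hQd t).continuousAt)
  have hmax : IsLocalMax Q s := Eventually.of_forall hs
  have h0 := hmax.hasDerivAt_eq_zero (hQd s)
  have hYs : Y s = 0 := by
    rw [div_eq_zero_iff] at h0
    simp only [hY]
    rw [h0.resolve_right (pow_pos (hy0 s) 2).ne', mul_zero]
  have hmono : StrictMonoOn Q (Ici s) := by
    refine strictMonoOn_of_deriv_pos (convex_Ici s)
      (fun t _ => (hQd t).continuousAt.continuousWithinAt) fun t ht => ?_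
    rw [interior_Ici] at ht
    rw [(hQd t).deriv]
    have h1 : 0 < Y t := hYs ▸ hYm ht
    exact div_pos (pos_of_mul_pos_right h1 (Real.exp_pos _).le) (pow_pos (hy0 t) 2)
  have := hmono (mem_Ici.2 le_rfl) (mem_Ici.2 (by linarith : s ≤ s + 1)) (by linarith : s < s + 1)
  linarith [hs (s + 1)]

theorem IsPosPeriodicSol.eq_or_eq_or_eq {T p b c μ : ℝ} {a e u v z : ℝ → ℝ} (hT : 0 < T)
    (hp : 0 < p) (ha : Continuous a) (haT : Function.Periodic a T) (hapos : ∀ t, 0 < a t)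
    (hb : 0 < b) (hbω : b < (2 * Real.pi / T) ^ 2) (hu : IsPosPeriodicSol T p b c a e μ u)
    (hv : IsPosPeriodicSol T p b c a e μ v) (hz : IsPosPeriodicSol T p b c a e μ z) :
    u = v ∨ v = z ∨ u = z := by
  by_contra! hne
  rcases hu.lt_or_gt hT hp ha haT hapos hb hbω hv hne.1 with h1 | h1 <;>
  rcases hv.lt_or_gt hT hp ha haT hapos hb hbω hz hne.2.1 with h2 | h2 <;>
  rcases hu.lt_or_gt hT hp ha haT hapos hb hbω hz hne.2.2 with h3 | h3
  · exact hu.not_lt_lt hT hp hapos hv hz h1 h2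
  · exact hu.not_lt_lt hT hp hapos hv hz h1 h2
  · exact hu.not_lt_lt hT hp hapos hz hv h3 h2
  · exact hz.not_lt_lt hT hp hapos hu hv h3 h1
  · exact hv.not_lt_lt hT hp hapos hu hz h1 h3
  · exact hv.not_lt_lt hT hp hapos hz hu h2 h3
  · exact hz.not_lt_lt hT hp hapos hv hu h2 h1
  · exact hz.not_lt_lt hT hp hapos hv hu h2 h1

/-! ### Parabola-like functions -/

/-- A continuous function on `(L, ∞)` tending to infinity at both ends and taking each value at
most twice is parabola-like. -/
theorem exists_isParabolaLike {φ : ℝ → ℝ} {L : ℝ} (hc : ContinuousOn φ (Ioi L))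
    (hl : Tendsto φ (𝓝[>] L) atTop) (hr : Tendsto φ atTop atTop)
    (h3 : ∀ x y z, L < x → x < y → y < z → φ x = φ y → φ y = φ z → False) :
    ∃ ξ₀, IsParabolaLike φ L ξ₀ (φ ξ₀) := by
  have hcI : ∀ x y, L < x → ContinuousOn φ (Icc x y) := fun x y hx =>
    hc.mono fun t ht => hx.trans_le ht.1
  have hright : ∀ y v, L < y → φ y < v → ∃ z, y < z ∧ φ z = v := by
    intro y v hy hv
    obtain ⟨R, hRv, hR⟩ := ((hr.eventually_ge_atTop v).and (eventually_ge_atTop y)).exists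
    obtain ⟨z, hz, hzv⟩ := intermediate_value_Icc hR (hcI y R hy) ⟨hv.le, hRv⟩
    exact ⟨z, lt_of_le_of_ne hz.1 fun h => by rw [← h] at hzv; exact hv.ne hzv, hzv⟩
  have hleft : ∀ y v, L < y → φ y < v → ∃ x, L < x ∧ x < y ∧ φ x = v := by
    intro y v hy hv
    obtain ⟨l, hlv, hl1⟩ := ((hl.eventually_ge_atTop v).and (Ioo_mem_nhdsGT hy)).exists
    obtain ⟨z, hz, hzv⟩ := intermediate_value_Icc' hl1.2.le (hcI l y hl1.1) ⟨hv.le, hlv⟩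
    exact ⟨z, hl1.1.trans_le hz.1,
      lt_of_le_of_ne hz.2 fun h => by rw [h] at hzv; exact hv.ne hzv, hzv⟩
  -- A point at least as high as points on both sides produces a value taken three times: a level
  -- reached on both flanks recurs farther out, where `φ` tends to infinity.
  have hquasi : ∀ x y z, L < x → x < y → y < z → φ x ≤ φ y → φ z ≤ φ y → False := by
    intro x y z hx hxy hyz hxy' hzy'
    have hy := hx.trans hxy
    have hz := hy.trans hyz
    rcases hxy'.eq_or_lt with h1 | h1
    · rcases hzy'.eq_or_lt with h2 | h2
      · exact h3 x y z hx hxy hyz h1 h2.symm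
      · obtain ⟨w, hw, hwv⟩ := hright z (φ y) hz h2
        exact h3 x y w hx hxy (hyz.trans hw) h1 hwv.symm
    · rcases hzy'.eq_or_lt with h2 | h2
      · obtain ⟨w, hLw, hw, hwv⟩ := hleft x (φ y) hx h1
        exact h3 w y z hLw (hw.trans hxy) hyz hwv h2.symm
      · obtain ⟨v, hv1, hv2⟩ := exists_between (max_lt h1 h2)
        obtain ⟨hxv, hzv⟩ := max_lt_iff.1 hv1
        obtain ⟨p, hp, hpv⟩ := intermediate_value_Icc hxy.le (hcI x y hx) ⟨hxv.le, hv2.le⟩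
        obtain ⟨q, hq, hqv⟩ := intermediate_value_Icc' hyz.le (hcI y z hy) ⟨hzv.le, hv2.le⟩
        obtain ⟨w, hw, hwv⟩ := hright z v hz hzv
        have hpy : p < y := lt_of_le_of_ne hp.2 fun h => by rw [h] at hpv; exact hv2.ne' hpv
        exact h3 p q w (hx.trans_le hp.1) (hpy.trans_le hq.1) (hq.2.trans_lt hw)
          (hpv.trans hqv.symm) (hqv.trans hwv.symm)
  obtain ⟨ξ₀, hξ₀, hmin⟩ : ∃ ξ₀, L < ξ₀ ∧ ∀ ξ, L < ξ → φ ξ₀ ≤ φ ξ := by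
    have hL1 : L < L + 1 := by linarith
    obtain ⟨l, hl0, hl1⟩ := mem_nhdsGT_iff_exists_Ioo_subset.1 (hl.eventually_ge_atTop (φ (L + 1)))
    obtain ⟨R, hR⟩ := eventually_atTop.1 (hr.eventually_ge_atTop (φ (L + 1)))
    have hl0 : L < l := hl0
    have hm : L < min l (L + 1) := lt_min hl0 hL1
    obtain ⟨x, hx, hxmin⟩ := isCompact_Icc.exists_isMinOn
      (s := Icc (min l (L + 1)) (max R (L + 1))) ⟨L + 1, min_le_right _ _, le_max_right _ _⟩
      (hcI _ _ hm)
    have hx1 : φ x ≤ φ (L + 1) := hxmin ⟨min_le_right _ _, le_max_right _ _⟩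
    refine ⟨x, hm.trans_le hx.1, fun ξ hξ => ?_⟩
    rcases lt_or_ge ξ (min l (L + 1)) with h | h
    · exact hx1.trans (hl1 ⟨hξ, h.trans_le (min_le_left _ _)⟩)
    · rcases le_total ξ (max R (L + 1)) with h' | h'
      · exact hxmin ⟨h, h'⟩
      · exact hx1.trans (hR ξ ((le_max_left _ _).trans h'))
  have hstrict : ∀ ξ, L < ξ → ξ ≠ ξ₀ → φ ξ₀ < φ ξ := by
    intro ξ hξ hne
    refine lt_of_le_of_ne (hmin ξ hξ) fun heq => ?_
    rcases lt_or_gt_of_ne hne with h | h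
    · obtain ⟨m, hm1, hm2⟩ := exists_between h
      have := hmin m (hξ.trans hm1)
      exact hquasi ξ m ξ₀ hξ hm1 hm2 (by linarith) this
    · obtain ⟨m, hm1, hm2⟩ := exists_between h
      have := hmin m (hξ₀.trans hm1)
      exact hquasi ξ₀ m ξ hξ₀ hm1 hm2 this (by linarith)
  refine ⟨ξ₀, hc, hξ₀, rfl, fun x hx y hy hxy => ?_, fun x hx y hy hxy => ?_, hl, hr⟩
  · rcases hy.2.eq_or_lt with h | h
    · rw [h]
      exact hstrict x hx.1 (by linarith [hy.2] : x < ξ₀).ne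
    · by_contra! hle
      exact hquasi x y ξ₀ hx.1 hxy h hle (hmin y hy.1)
  · have hx : ξ₀ ≤ x := hx
    rcases hx.eq_or_lt with h | h
    · rw [← h] at hxy ⊢
      exact hstrict y (hξ₀.trans hxy) hxy.ne'
    · by_contra! hle
      exact hquasi ξ₀ x y hξ₀ h hxy (hmin x (hξ₀.trans h)) hle

namespace IsParabolaLike

variable {φ : ℝ → ℝ} {L ξ₀ μ₀ : ℝ}

theorem lt_of_ne (h : IsParabolaLike φ L ξ₀ μ₀) {ξ : ℝ} (hξ : L < ξ) (hne : ξ ≠ ξ₀) :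
    μ₀ < φ ξ := by
  rw [← h.vertex_val]
  rcases lt_or_gt_of_ne hne with h1 | h1
  · exact h.strictAntiOn ⟨hξ, h1.le⟩ ⟨h.vertex_mem, le_rfl⟩ h1
  · exact h.strictMonoOn (mem_Ici.2 le_rfl) (mem_Ici.2 h1.le) h1

theorem le (h : IsParabolaLike φ L ξ₀ μ₀) {ξ : ℝ} (hξ : L < ξ) : μ₀ ≤ φ ξ := by
  rcases eq_or_ne ξ ξ₀ with rfl | hne
  · exact h.vertex_val.ge
  · exact (h.lt_of_ne hξ hne).le

theorem exists_level_set (h : IsParabolaLike φ L ξ₀ μ₀) {μ : ℝ} (hμ : μ₀ < μ) :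
    ∃ x y, L < x ∧ x < ξ₀ ∧ ξ₀ < y ∧ φ x = μ ∧ φ y = μ ∧ ∀ ξ, L < ξ → φ ξ = μ → ξ = x ∨ ξ = y := by
  have hv : φ ξ₀ < μ := by rwa [h.vertex_val]
  obtain ⟨l, hlv, hl1⟩ := ((h.tendsto_left.eventually_ge_atTop μ).and
    (Ioo_mem_nhdsGT h.vertex_mem)).exists
  obtain ⟨x, hx, hxv⟩ := intermediate_value_Icc' hl1.2.le
    (h.continuousOn.mono fun t ht => hl1.1.trans_le ht.1) ⟨hv.le, hlv⟩
  obtain ⟨R, hRv, hR⟩ := ((h.tendsto_right.eventually_ge_atTop μ).and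
    (eventually_ge_atTop ξ₀)).exists
  obtain ⟨y, hy, hyv⟩ := intermediate_value_Icc hR
    (h.continuousOn.mono fun t ht => h.vertex_mem.trans_le ht.1) ⟨hv.le, hRv⟩
  have hxL : L < x := hl1.1.trans_le hx.1
  refine ⟨x, y, hxL, lt_of_le_of_ne hx.2 fun h => ?_, lt_of_le_of_ne hy.1 fun h => ?_, hxv, hyv,
    fun ξ hξ hξv => ?_⟩
  · rw [h] at hxv; exact hv.ne hxv
  · rw [← h] at hyv; exact hv.ne hyv
  · rcases le_total ξ ξ₀ with h1 | h1
    · exact Or.inl (h.strictAntiOn.injOn ⟨hξ, h1⟩ ⟨hxL, hx.2⟩ (hξv.trans hxv.symm))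
    · exact Or.inr (h.strictMonoOn.injOn h1 hy.1 (hξv.trans hyv.symm))

end IsParabolaLike

/-! ### Bounds for the parameter `μ` -/

theorem IsPosPeriodicSol.mul_periodAverage_lt {T p b c μ : ℝ} {a e u : ℝ → ℝ} (hT : 0 < T)
    (ha : Continuous a) (hapos : ∀ t, 0 < a t)
    (he : Continuous e) (hemean : ∫ t in (0 : ℝ)..T, e t = 0)
    (hu : IsPosPeriodicSol T p b c a e μ u) : b * periodAverage T u < μ := by
  have huc := hu.jet.cont
  have huc' := hu.jet.cont'
  have huc'' := hu.jet.cont''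
  have hcont : Continuous fun t => a t * u t ^ (-p) :=
    ha.mul (huc.rpow_const fun t => Or.inl (hu.pos t).ne')
  have h1 : 0 < ∫ t in (0 : ℝ)..T, a t * u t ^ (-p) :=
    intervalIntegral_pos_of_pos_on (hcont.intervalIntegrable _ _)
      (fun t _ => mul_pos (hapos t) (Real.rpow_pos_of_pos (hu.pos t) _)) hT
  have h2 : ∫ t in (0 : ℝ)..T, a t * u t ^ (-p)
      = ∫ t in (0 : ℝ)..T, (μ + e t - (deriv (deriv u) t + c * deriv u t + b * u t)) :=
    integral_congr fun t _ => by have := hu.eqn_rpow_neg t; linarith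
  rw [h2, intervalIntegral.integral_sub, intervalIntegral.integral_add,
    intervalIntegral.integral_add, intervalIntegral.integral_add] at h1
  rotate_left
  any_goals exact Continuous.intervalIntegrable (by fun_prop) _ _
  simp only [intervalIntegral.integral_const_mul, hu.jet.integral_deriv, hu.jet.integral_deriv',
    hemean, (periodAverage_eq_iff (u := u) hT).1 rfl, intervalIntegral.integral_const,
    smul_eq_mul] at h1
  have h3 : 0 < T * (μ - b * periodAverage T u) := by linarith
  linarith [pos_of_mul_pos_right h3 hT.le]

/-- Evaluate the equation at the minimum of `u`, where `u' = 0`, `u'' ≥ 0` and `u` is at most its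
average. -/
theorem IsPosPeriodicSol.mul_rpow_neg_le {T p b c μ A E : ℝ} {a e u : ℝ → ℝ} (hT : 0 < T)
    (hp : 0 < p) (hb : 0 < b) (hA0 : 0 < A) (hA : ∀ t, A ≤ a t) (hE : ∀ t, |e t| ≤ E)
    (hu : IsPosPeriodicSol T p b c a e μ u) : A * periodAverage T u ^ (-p) - E ≤ μ := by
  obtain ⟨s, hs⟩ := hu.periodic.exists_forall_le_of_continuous hT hu.jet.cont
  have hsξ : u s ≤ periodAverage T u := by
    have := integral_mono_on hT.le (intervalIntegrable_const (μ := volume) (c := u s))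
      (hu.jet.cont.intervalIntegrable 0 T) fun t _ => hs t
    rw [(periodAverage_eq_iff (u := u) hT).1 rfl, intervalIntegral.integral_const, smul_eq_mul,
      sub_zero, mul_comm] at this
    exact le_of_mul_le_mul_right this hT
  obtain ⟨h1, h2⟩ := second_deriv_nonneg_of_forall_le hu.jet.hasDerivAt hu.jet.hasDerivAt' hs
  have h3 := hu.eqn_rpow_neg s
  rw [h1] at h3
  have h4 : A * periodAverage T u ^ (-p) ≤ a s * u s ^ (-p) :=
    mul_le_mul (hA s) (Real.rpow_le_rpow_of_nonpos (hu.pos s) hsξ (by linarith))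
      (Real.rpow_nonneg (hu.periodAverage_pos hT).le _) (hA0.le.trans (hA s))
  have h5 := mul_pos hb (hu.pos s)
  linarith [(abs_le.1 (hE s)).2]

/-! ### The solution curve and the exact count -/

theorem mainTheorem2
    (T p b c : ℝ) (a e : ℝ → ℝ)
    (hT : 0 < T) (hp : 0 < p)
    (ha : Continuous a) (haT : Function.Periodic a T) (hapos : ∀ t, 0 < a t)
    (he : Continuous e) (heT : Function.Periodic e T) (hemean : ∫ t in (0 : ℝ)..T, e t = 0)
    (hb : 0 < b) (hbω : b < (2 * Real.pi / T) ^ 2) :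
    ∃ μ₀ : ℝ, 0 < μ₀ ∧
      -- the exact number of positive periodic solutions
      (∀ μ : ℝ, μ₀ < μ → {u : ℝ → ℝ | IsPosPeriodicSol T p b c a e μ u}.encard = 2) ∧
      {u : ℝ → ℝ | IsPosPeriodicSol T p b c a e μ₀ u}.encard = 1 ∧
      (∀ μ : ℝ, μ < μ₀ → {u : ℝ → ℝ | IsPosPeriodicSol T p b c a e μ u} = ∅) ∧
      -- the global solution curve
      ∃ (ξbar ξ₀ : ℝ) (φ : ℝ → ℝ) (sol : ℝ → ℝ → ℝ),
        0 ≤ ξbar ∧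
        IsParabolaLike φ ξbar ξ₀ μ₀ ∧
        -- the curve consists of solutions, and its parameter is the average
        (∀ ξ : ℝ, ξbar < ξ →
          IsPosPeriodicSol T p b c a e (φ ξ) (sol ξ) ∧ periodAverage T (sol ξ) = ξ) ∧
        -- every solution lies on the curve, and its average determines the pair `(u, μ)`
        (∀ (μ : ℝ) (u : ℝ → ℝ), IsPosPeriodicSol T p b c a e μ u →
          ξbar < periodAverage T u ∧
          μ = φ (periodAverage T u) ∧ u = sol (periodAverage T u)) ∧
        -- the solution depends continuously on the average, in the `H²` norm over a period
        (∀ ξ : ℝ, ξbar < ξ →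
          Tendsto (fun η => sqDistH2 T (sol η) (sol ξ)) (𝓝 ξ) (𝓝 0)) ∧
        ((∃ k : ℝ, ∀ t, a t = k) → ξbar = 0) := by
  have hex : ∀ ξ : ℝ, ∃ (μ : ℝ) (u : ℝ → ℝ), 0 < ξ →
      IsPosPeriodicSol T p b c a e μ u ∧ periodAverage T u = ξ := by
    intro ξ
    by_cases hξ : 0 < ξ
    · obtain ⟨μ, u, h⟩ := exists_isPosPeriodicSol (c := c) hT hp ha haT hapos he heT hemean hb hbω hξ
      exact ⟨μ, u, fun _ => h⟩
    · exact ⟨0, 0, fun h => absurd h hξ⟩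
  choose φ sol hsol using hex
  have huniq : ∀ (μ : ℝ) (u : ℝ → ℝ), IsPosPeriodicSol T p b c a e μ u →
      0 < periodAverage T u ∧ μ = φ (periodAverage T u) ∧ u = sol (periodAverage T u) := by
    intro μ u hu
    have hpos := hu.periodAverage_pos hT
    exact ⟨hpos, hu.unique_of_periodAverage_eq hT hp ha haT hapos he heT hemean hb hbω
      (hsol _ hpos).1 (hsol _ hpos).2.symm⟩
  have hlip : ∀ ξ : ℝ, 0 < ξ → ∃ C, 0 ≤ C ∧ ∀ᶠ η in 𝓝 ξ, |φ η - φ ξ| ≤ C * |η - ξ| ∧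
      sqDistH2 T (sol η) (sol ξ) ≤ C * (η - ξ) ^ 2 := by
    intro ξ hξ
    obtain ⟨C, hC0, hC⟩ := IsPosPeriodicSol.exists_lipschitz_bound (c := c) hT hp ha haT hapos he
      heT hemean hb hbω (half_pos hξ)
    refine ⟨C, hC0, ?_⟩
    filter_upwards [lt_mem_nhds (half_lt_self hξ)] with η hη
    obtain ⟨h1, h2⟩ := hsol η ((half_pos hξ).trans hη)
    obtain ⟨h3, h4⟩ := hsol ξ hξ
    obtain ⟨-, h5, h6⟩ := hC _ _ _ _ h1 h3 (by rw [h2]; exact hη.le)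
      (by rw [h4]; exact (half_lt_self hξ).le)
    rw [h2, h4] at h5 h6
    exact ⟨h5, h6⟩
  have hsq0 : ∀ u v : ℝ → ℝ, 0 ≤ sqDistH2 T u v := fun u v =>
    integral_nonneg hT.le fun t _ => by positivity
  have hcont : ContinuousOn φ (Ioi 0) := by
    intro ξ hξ
    obtain ⟨C, -, hC⟩ := hlip ξ hξ
    refine ContinuousAt.continuousWithinAt ?_
    rw [ContinuousAt, tendsto_iff_dist_tendsto_zero]
    refine squeeze_zero' (Eventually.of_forall fun _ => dist_nonneg)
      (hC.mono fun η hη => (Real.dist_eq _ _).trans_le hη.1) ?_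
    have : ContinuousAt (fun η => C * |η - ξ|) ξ := by fun_prop
    simpa [ContinuousAt] using this
  have hleft : Tendsto φ (𝓝[>] 0) atTop := by
    obtain ⟨s, hs⟩ := haT.exists_forall_le_of_continuous hT ha
    obtain ⟨E, -, hE⟩ := heT.exists_abs_le_of_continuous hT he
    have h1 : Tendsto (fun ξ : ℝ => a s * ξ ^ (-p) - E) (𝓝[>] 0) atTop :=
      tendsto_atTop_add_const_right _ _
        ((tendsto_rpow_neg_nhdsGT_zero (by linarith)).const_mul_atTop (hapos s))
    refine tendsto_atTop_mono' _ ?_ h1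
    filter_upwards [self_mem_nhdsWithin] with ξ hξ
    obtain ⟨h2, h3⟩ := hsol ξ hξ
    have := h2.mul_rpow_neg_le hT hp hb (hapos s) hs hE
    rwa [h3] at this
  have hbφ : ∀ ξ, 0 < ξ → b * ξ < φ ξ := fun ξ hξ => by
    obtain ⟨h2, h3⟩ := hsol ξ hξ
    have := h2.mul_periodAverage_lt hT ha hapos he hemean
    rwa [h3] at this
  have hright : Tendsto φ atTop atTop :=
    tendsto_atTop_mono' _ ((eventually_gt_atTop 0).mono fun ξ hξ => (hbφ ξ hξ).le)
      (tendsto_id.const_mul_atTop hb)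
  have hne : ∀ x y, 0 < x → x < y → sol x ≠ sol y := fun x y hx hxy h => by
    have h1 := (hsol x hx).2
    rw [h, (hsol y (hx.trans hxy)).2] at h1
    exact hxy.ne' h1
  -- Three equal values of `φ` would give three solutions for one `μ`, distinct because their
  -- averages differ.
  obtain ⟨ξ₀, hφ⟩ := exists_isParabolaLike hcont hleft hright fun x y z hx hxy hyz h1 h2 => by
    have hy := hx.trans hxy
    have sx := (hsol x hx).1
    have sy := (hsol y hy).1
    have sz := (hsol z (hy.trans hyz)).1
    rw [h1] at sx
    rw [← h2] at sz
    rcases sx.eq_or_eq_or_eq hT hp ha haT hapos hb hbω sy sz with h | h | h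
    · exact hne x y hx hxy h
    · exact hne y z hy hyz h
    · exact hne x z hx (hxy.trans hyz) h
  -- `μ₀ > 0` follows from `0 < b ξ₀ < φ ξ₀`. As `ξbar` is `0` for every `a`, the clause on constant
  -- `a` is immediate.
  refine ⟨φ ξ₀, (mul_pos hb hφ.vertex_mem).trans (hbφ ξ₀ hφ.vertex_mem), fun μ hμ => ?_, ?_,
    fun μ hμ => ?_, 0, ξ₀, φ, sol, le_rfl, hφ, hsol, huniq, fun ξ hξ => ?_, fun _ => rfl⟩
  · obtain ⟨x, y, hx, hxξ, hξy, hxμ, hyμ, hlevel⟩ := hφ.exists_level_set hμ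
    have hxy := hxξ.trans hξy
    have hset : {u : ℝ → ℝ | IsPosPeriodicSol T p b c a e μ u} = {sol x, sol y} := by
      ext u
      simp only [mem_ofPred_eq, mem_insert_iff, mem_singleton_iff]
      constructor
      · intro hu
        obtain ⟨h1, h2, h3⟩ := huniq μ u hu
        rcases hlevel _ h1 h2.symm with h | h
        · exact Or.inl (by rw [← h]; exact h3)
        · exact Or.inr (by rw [← h]; exact h3)
      · rintro (rfl | rfl)
        · exact hxμ ▸ (hsol x hx).1
        · exact hyμ ▸ (hsol y (hx.trans hxy)).1
    rw [hset]
    exact encard_pair (hne x y hx hxy)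
  · have hset : {u : ℝ → ℝ | IsPosPeriodicSol T p b c a e (φ ξ₀) u} = {sol ξ₀} := by
      ext u
      simp only [mem_ofPred_eq, mem_singleton_iff]
      constructor
      · intro hu
        obtain ⟨h1, h2, h3⟩ := huniq _ u hu
        have : periodAverage T u = ξ₀ := by
          by_contra hcon
          exact (hφ.lt_of_ne h1 hcon).ne h2
        rw [this] at h3
        exact h3
      · rintro rfl
        exact (hsol ξ₀ hφ.vertex_mem).1
    rw [hset]
    exact encard_singleton _
  · refine eq_empty_of_forall_notMem fun u hu => ?_
    obtain ⟨h1, h2, -⟩ := huniq μ u hu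
    exact absurd (hφ.le h1) (by rw [← h2]; exact not_le.2 hμ)
  · obtain ⟨C, -, hC⟩ := hlip ξ hξ
    refine squeeze_zero' (Eventually.of_forall fun _ => hsq0 _ _) (hC.mono fun η hη => hη.2) ?_
    have : ContinuousAt (fun η => C * (η - ξ) ^ 2) ξ := by fun_prop
    simpa [ContinuousAt] using this
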